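/- Let $\mathbb{F}$ be a field of characteristic zero and let $\mathfrak{p}=\coprod_{j\in\mathbb{Z}}\mathfrak{p}_j$ be a $\mathbb{Z}$-graded Lie algebra over $\mathbb{F}$. Put $\mathfrak{p}^-=\coprod_{j<0}\mathfrak{p}_j$ and $\mathfrak{p}^+=\coprod_{j>0}\mathfrak{p}_j$. Let $\mathcal{A}_j$ ($j>0$) and $\mathcal{B}_j$ ($j<0$) be commuting formal variables. For a vector space $V$, let $V[[\mathcal{A},\mathcal{B}]]$ be the space of formal power series in all these variables with coefficients in $V$; $\mathfrak{p}[[\mathcal{A},\mathcal{B}]]$ is a Lie algebra and $U(\mathfrak{p})[[\mathcal{A},\mathcal{B}]]$ an associative algebra in the canonical way, where $U(\mathfrak{p})$ is the universal enveloping algebra. The order of a monomial in the $\mathcal{A}_j$'s (in the $\mathcal{B}_j$'s) is the number of factors $\mathcal{A}_j$ (of factors $\mathcal{B}_j$) in it, and the total order is the sum of the two. Let $\pi^-,\pi^0,\pi^+$ be the projections of $\mathfrak{p}[[\mathcal{A},\mathcal{B}]]=\mathfrak{p}^-[[\mathcal{A},\mathcal{B}]]\oplus\mathfrak{p}_0[[\mathcal{A},\mathcal{B}]]\oplus\mathfrak{p}^+[[\mathcal{A},\mathcal{B}]]$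 onto the three summands. Fix $p_j\in\mathfrak{p}_j$ for every $j\neq0$ and put $$g^+=\sum_{j>0}\mathcal{A}_jp_j,\qquad g^-=\sum_{j<0}\mathcal{B}_jp_j .$$ Then there exist unique elements $\Psi^-\in\mathfrak{p}^-[[\mathcal{A},\mathcal{B}]]$, $\Psi^0\in\mathfrak{p}_0[[\mathcal{A},\mathcal{B}]]$ and $\Psi^+\in\mathfrak{p}^+[[\mathcal{A},\mathcal{B}]]$ of the form $$\Psi^-=\sum_{j<0}\mathcal{B}_jp_j+\mathcal{Q}^-,\qquad \Psi^0=\mathcal{Q}^0,\qquad \Psi^+=\sum_{j>0}\mathcal{A}_jp_j+\mathcal{Q}^+,\tag{1}$$ where $\mathcal{Q}^-\in\mathfrak{p}^-[[\mathcal{A},\mathcal{B}]]$, $\mathcal{Q}^0\in\mathfrak{p}_0[[\mathcal{A},\mathcal{B}]]$, $\mathcal{Q}^+\in\mathfrak{p}^+[[\mathcal{A},\mathcal{B}]]$ contain only terms of order at least one in the $\mathcal{A}_j$'s and at least one in the $\mathcal{B}_j$'s, such that $$e^{g^+}e^{g^-}=e^{\Psi^-}e^{\Psi^+}e^{\Psi^0}\quad\text{in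 } U(\mathfrak{p})[[\mathcal{A},\mathcal{B}]].$$ Here $e^f=\sum_{k\ge0}f^k/k!$, which is well defined for $f=g^\pm$ and for all series of the form (1), in the sense that each monomial occurs in only finitely many of the powers $f^k$. Moreover, $\Psi^-,\Psi^0,\Psi^+$ lie in $\mathbb{F}\langle\langle g^-,g^+;\pi^-,\pi^0,\pi^+\rangle\rangle$, the space of formal (possibly infinite) linear combinations of words built from $g^-$ and $g^+$ by Lie brackets and the projections $\pi^-,\pi^0,\pi^+$; that is, for all $m,n\ge0$, the part of each of these series of order $m$ in the $\mathcal{B}_j$'s and $n$ in the $\mathcal{A}_j$'s is a finite linear combination of such words with exactly $m$ letters $g^-$ and exactly $n$ letters $g^+$. Finally, $$\Psi^-=\sum_{j<0}\mathcal{B}_jp_j+\sum_{\substack{j>0,\,m<0\\ j+m<0}}\mathcal{A}_j\mathcal{B}_m[p_j,p_m]+\mathcal{P}^-,$$ $$\Psi^0=\sum_{j>0}\mathcal{A}_j\mathcal{B}_{-j}[p_j,p_{-j}]+\mathcal{P}^0,$$ $$\Psi^+=\sum_{j>0}\mathcal{A}_jp_j+\sum_{\substack{j>0,\,m<0\\ j+m>0}}\mathcal{A}_j\mathcal{B}_m[p_j,p_m]+\mathcal{P}^+,$$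 where $\mathcal{P}^-,\mathcal{P}^0,\mathcal{P}^+\in\mathfrak{p}[[\mathcal{A},\mathcal{B}]]$ contain only terms of total order at least three, with order at least one in the $\mathcal{A}_j$'s and at least one in the $\mathcal{B}_j$'s. -/

import Mathlib

namespace GradedUniformization

open Finset

/-- The formal variables: `Sum.inl j` is `𝒜_j` for `j > 0`, `Sum.inr j` is `ℬ_j` for `j < 0`. -/
abbrev Var : Type := {j : ℤ // 0 < j} ⊕ {j : ℤ // j < 0}

/-- A monomial in the commuting variables `𝒜_j`, `ℬ_j`, given by its exponents. -/
abbrev Mon : Type := Var →₀ ℕ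

/-- The monomial `𝒜_j`. -/
noncomputable def monA (j : {j : ℤ // 0 < j}) : Mon := Finsupp.single (Sum.inl j) 1

/-- The monomial `ℬ_j`. -/
noncomputable def monB (j : {j : ℤ // j < 0}) : Mon := Finsupp.single (Sum.inr j) 1

/-- The order of a monomial in the `𝒜_j`'s. -/
def orderA (d : Mon) : ℕ := d.sum fun v k => Sum.elim (fun _ => k) (fun _ => 0) v

/-- The order of a monomial in the `ℬ_j`'s. -/
def orderB (d : Mon) : ℕ := d.sum fun v k => Sum.elim (fun _ => 0) (fun _ => k) v

/-! ### Power series with coefficients in a Lie algebra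

`MvPowerSeries σ L` is the vector space `L[[X_i : i ∈ σ]]`; the coefficient of the monomial `d`
in `f` is `f d`. -/

section Bracket

variable {σ L : Type*} [LieRing L]

/-- The Lie bracket of `L` extended to power series:
`[∑ x_a X^a, ∑ y_b X^b] = ∑ [x_a, y_b] X^(a+b)`. -/
noncomputable def serBracket (f g : MvPowerSeries σ L) : MvPowerSeries σ L :=
  open Classical in
  fun d => ∑ ab ∈ antidiagonal d, ⁅f ab.1, g ab.2⁆

theorem serBracket_leibniz (f g h : MvPowerSeries σ L) :
    serBracket f (serBracket g h) =
      serBracket (serBracket f g) h + serBracket g (serBracket f h) := by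
  classical
  funext d
  have add_app : ∀ (u v : MvPowerSeries σ L), (u + v) d = u d + v d := fun _ _ => rfl
  rw [add_app]
  simp only [serBracket, sum_lie, lie_sum]
  have e1 : (∑ ab ∈ antidiagonal d, ∑ i ∈ antidiagonal ab.2, ⁅f ab.1, ⁅g i.1, h i.2⁆⁆)
      = (∑ ab ∈ antidiagonal d, ∑ i ∈ antidiagonal ab.2, ⁅⁅f ab.1, g i.1⁆, h i.2⁆)
        + ∑ ab ∈ antidiagonal d, ∑ i ∈ antidiagonal ab.2, ⁅g i.1, ⁅f ab.1, h i.2⁆⁆ := by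
    rw [← sum_add_distrib]
    refine sum_congr rfl fun ab _ => ?_
    rw [← sum_add_distrib]
    exact sum_congr rfl fun i _ => leibniz_lie _ _ _
  rw [e1]
  congr 1
  · rw [sum_sigma', sum_sigma']
    refine sum_nbij' (fun x => ⟨(x.1.1 + x.2.1, x.2.2), (x.1.1, x.2.1)⟩)
      (fun x => ⟨(x.2.1, x.2.2 + x.1.2), (x.2.2, x.1.2)⟩) ?_ ?_ ?_ ?_ ?_
    all_goals rintro ⟨⟨a, b⟩, ⟨c, e⟩⟩; simp only [mem_sigma, HasAntidiagonal.mem_antidiagonal]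
    all_goals rintro ⟨rfl, rfl⟩; simp [add_assoc]
  · rw [sum_sigma', sum_sigma']
    refine sum_nbij' (fun x => ⟨(x.2.1, x.1.1 + x.2.2), (x.1.1, x.2.2)⟩)
      (fun x => ⟨(x.2.1, x.1.1 + x.2.2), (x.1.1, x.2.2)⟩) ?_ ?_ ?_ ?_ ?_
    all_goals rintro ⟨⟨a, b⟩, ⟨c, e⟩⟩; simp only [mem_sigma, HasAntidiagonal.mem_antidiagonal]
    all_goals rintro ⟨rfl, rfl⟩; simp [add_left_comm]

noncomputable instance : LieRing (MvPowerSeries σ L) where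
  bracket := serBracket
  add_lie f g h := by
    funext d
    exact (sum_congr rfl fun ab _ => add_lie (f ab.1) (g ab.1) (h ab.2)).trans sum_add_distrib
  lie_add f g h := by
    funext d
    exact (sum_congr rfl fun ab _ => lie_add (f ab.1) (g ab.2) (h ab.2)).trans sum_add_distrib
  lie_self f := by
    classical
    funext d
    change ∑ ab ∈ antidiagonal d, ⁅f ab.1, f ab.2⁆ = 0
    refine sum_involution (fun ab _ => ab.swap) ?_ ?_ ?_ ?_
    · intro ab _
      rw [Prod.fst_swap, Prod.snd_swap, ← lie_skew (f ab.1) (f ab.2), neg_add_cancel]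
    · rintro ⟨a, b⟩ _ h h'
      simp only [Prod.swap_prod_mk, Prod.mk.injEq] at h'
      exact h (by rw [h'.1]; exact lie_self _)
    · intro ab h
      rw [HasAntidiagonal.mem_antidiagonal] at h ⊢
      rw [Prod.fst_swap, Prod.snd_swap, add_comm, h]
    · intro ab _
      exact Prod.swap_swap ab
  leibniz_lie := serBracket_leibniz

noncomputable instance {F : Type*} [CommRing F] [LieAlgebra F L] :
    LieAlgebra F (MvPowerSeries σ L) where
  lie_smul c f g := by
    funext d
    exact (sum_congr rfl fun ab _ => lie_smul c (f ab.1) (g ab.2)).trans smul_sum.symm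

end Bracket

section Series

variable {L : Type*} [AddCommGroup L]

/-- The formal sum `∑ i, x i • X^(d i)`, for monomials `d i` each of which occurs for finitely
many `i` only. -/
noncomputable def formalSum {ι : Type*} (d : ι → Mon) (x : ι → L) : MvPowerSeries Var L :=
  fun n => ∑ᶠ (i : ι) (_ : d i = n), x i

/-- `f` contains only terms of order at least one in the `𝒜_j`'s and at least one in
the `ℬ_j`'s. -/
def OnlyMixedTerms (f : MvPowerSeries Var L) : Prop :=
  ∀ d, f d ≠ 0 → 1 ≤ orderA d ∧ 1 ≤ orderB d

/-- `f` contains only terms of total order at least three, with order at least one in the `𝒜_j`'s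
and at least one in the `ℬ_j`'s. -/
def OnlyHigherMixedTerms (f : MvPowerSeries Var L) : Prop :=
  ∀ d, f d ≠ 0 → 3 ≤ orderA d + orderB d ∧ 1 ≤ orderA d ∧ 1 ≤ orderB d

/-- The part of `f` of order `m` in the `ℬ_j`'s and of order `n` in the `𝒜_j`'s. -/
def bihomPart (m n : ℕ) (f : MvPowerSeries Var L) : MvPowerSeries Var L :=
  fun d => if orderB d = m ∧ orderA d = n then f d else 0

end Series

section Exp

variable (F : Type*) {A : Type*} [Field F] [Ring A] [Algebra F A]

/-- `∑ k, f ^ k / k!` is well defined: each monomial occurs in finitely many `f ^ k` only. -/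
def ExpDefined (f : MvPowerSeries Var A) : Prop :=
  ∀ d, {k : ℕ | MvPowerSeries.coeff d (f ^ k) ≠ 0}.Finite

/-- The formal exponential `e^f = ∑ k, f ^ k / k!`, computed coefficient by coefficient. -/
noncomputable def formalExp (f : MvPowerSeries Var A) : MvPowerSeries Var A :=
  fun d => ∑ᶠ k : ℕ, ((k.factorial : F)⁻¹) • MvPowerSeries.coeff d (f ^ k)

end Exp

section Graded

variable {F 𝔭 : Type*} [Field F] [LieRing 𝔭] [LieAlgebra F 𝔭]

variable (F) in
/-- The inclusion of `𝔭[[𝒜, ℬ]]` in `U(𝔭)[[𝒜, ℬ]]`. -/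
noncomputable def toU (f : MvPowerSeries Var 𝔭) :
    MvPowerSeries Var (UniversalEnvelopingAlgebra F 𝔭) :=
  fun d => UniversalEnvelopingAlgebra.ι F (f d)

/-- The series in `U(𝔭)[[𝒜, ℬ]]` that is the exponential of a series in `𝔭[[𝒜, ℬ]]`. -/
noncomputable def expU (F : Type*) {𝔭 : Type*} [Field F] [LieRing 𝔭] [LieAlgebra F 𝔭]
    (f : MvPowerSeries Var 𝔭) : MvPowerSeries Var (UniversalEnvelopingAlgebra F 𝔭) :=
  formalExp F (toU F f)

/-- `⨁_{j ∈ S} 𝔭_j` as a subspace of `𝔭`: it is `𝔭⁻`, `𝔭₀`, `𝔭⁺` for `S` the set of negative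
integers, `{0}`, and the set of positive integers. -/
def gradedPart (ℒ : ℤ → Submodule F 𝔭) (S : Set ℤ) : Submodule F 𝔭 := ⨆ j ∈ S, ℒ j

/-- `f` has all its coefficients in `⨁_{j ∈ S} 𝔭_j`. -/
def HasCoeffsIn (ℒ : ℤ → Submodule F 𝔭) (S : Set ℤ) (f : MvPowerSeries Var 𝔭) : Prop :=
  ∀ d, f d ∈ gradedPart ℒ S

variable (ℒ : ℤ → Submodule F 𝔭) [GradedLieAlgebra ℒ]

/-- The projection of `𝔭` onto `⨁_{j ∈ S} 𝔭_j` that kills `𝔭_j` for `j ∉ S`. -/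
noncomputable def gradedProj (S : Set ℤ) : 𝔭 →ₗ[F] 𝔭 :=
  open Classical in
  (DirectSum.toModule F ℤ 𝔭 fun j => if j ∈ S then (ℒ j).subtype else 0) ∘ₗ
    (DirectSum.decomposeLinearEquiv ℒ).toLinearMap

/-- The projection `gradedProj`, extended to `𝔭[[𝒜, ℬ]]`. -/
noncomputable def serProj (S : Set ℤ) (f : MvPowerSeries Var 𝔭) : MvPowerSeries Var 𝔭 :=
  fun d => gradedProj ℒ S (f d)

/-- `g⁺ = ∑_{j > 0} 𝒜_j p_j`. -/
noncomputable def gPlus (p : {j : ℤ // 0 < j} → 𝔭) : MvPowerSeries Var 𝔭 := formalSum monA p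

/-- `g⁻ = ∑_{j < 0} ℬ_j p_j`. -/
noncomputable def gMinus (p : {j : ℤ // j < 0} → 𝔭) : MvPowerSeries Var 𝔭 := formalSum monB p

/-- `∑ 𝒜_j ℬ_m [p_j, p_m]` over all `j > 0` and `m < 0` with `j + m ∈ S`. -/
noncomputable def orderTwo (p : {j : ℤ // 0 < j} → 𝔭) (q : {j : ℤ // j < 0} → 𝔭) (S : Set ℤ) :
    MvPowerSeries Var 𝔭 :=
  formalSum
    (ι := {x : {j : ℤ // 0 < j} × {j : ℤ // j < 0} // (x.1 : ℤ) + (x.2 : ℤ) ∈ S})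
    (fun x => monA x.1.1 + monB x.1.2) (fun x => ⁅p x.1.1, q x.1.2⁆)

/-- `IsWord ℒ u v m n w`: the series `w` is the value of a word built from exactly `m` copies
of `u` and exactly `n` copies of `v` by Lie brackets and the projections `π⁻`, `π⁰`, `π⁺`. -/
inductive IsWord (ℒ : ℤ → Submodule F 𝔭) [GradedLieAlgebra ℒ] (u v : MvPowerSeries Var 𝔭) :
    ℕ → ℕ → MvPowerSeries Var 𝔭 → Prop
  | left : IsWord ℒ u v 1 0 u
  | right : IsWord ℒ u v 0 1 v
  | bracket {m n m' n' : ℕ} {w w' : MvPowerSeries Var 𝔭} :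
      IsWord ℒ u v m n w → IsWord ℒ u v m' n' w' → IsWord ℒ u v (m + m') (n + n') ⁅w, w'⁆
  | projNeg {m n : ℕ} {w : MvPowerSeries Var 𝔭} :
      IsWord ℒ u v m n w → IsWord ℒ u v m n (serProj ℒ (Set.Iio 0) w)
  | projZero {m n : ℕ} {w : MvPowerSeries Var 𝔭} :
      IsWord ℒ u v m n w → IsWord ℒ u v m n (serProj ℒ {0} w)
  | projPos {m n : ℕ} {w : MvPowerSeries Var 𝔭} :
      IsWord ℒ u v m n w → IsWord ℒ u v m n (serProj ℒ (Set.Ioi 0) w)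

/-- `f` lies in the formal completion `F⟨⟨g⁻, g⁺; π⁻, π⁰, π⁺⟩⟩`. A word with `m` letters `g⁻` and
`n` letters `g⁺` is homogeneous of order `m` in the `ℬ_j`'s and `n` in the `𝒜_j`'s, so an infinite
linear combination of words, with finitely many words for each `(m, n)`, is a series whose part of
order `(m, n)` is a finite linear combination of words with `m` letters `g⁻` and `n`
letters `g⁺`. -/
def IsWordSeries (p : {j : ℤ // 0 < j} → 𝔭) (q : {j : ℤ // j < 0} → 𝔭)
    (f : MvPowerSeries Var 𝔭) : Prop :=
  ∀ m n : ℕ, bihomPart m n f ∈ Submodule.span F {w | IsWord ℒ (gMinus q) (gPlus p) m n w}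

/-- The prescribed form of a triple `(Ψ⁻, Ψ⁰, Ψ⁺)`: `Ψ⁻ = ∑_{j < 0} ℬ_j p_j + 𝒬⁻`, `Ψ⁰ = 𝒬⁰` and
`Ψ⁺ = ∑_{j > 0} 𝒜_j p_j + 𝒬⁺`, where `𝒬⁻`, `𝒬⁰`, `𝒬⁺` have coefficients in `𝔭⁻`, `𝔭₀`, `𝔭⁺` and
contain only terms of order at least one in the `𝒜_j`'s and at least one in the `ℬ_j`'s. -/
def HasPrescribedForm (ℒ : ℤ → Submodule F 𝔭)
    (p : {j : ℤ // 0 < j} → 𝔭) (q : {j : ℤ // j < 0} → 𝔭)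
    (Ψm Ψ0 Ψp : MvPowerSeries Var 𝔭) : Prop :=
  HasCoeffsIn ℒ (Set.Iio 0) Ψm ∧ HasCoeffsIn ℒ {0} Ψ0 ∧ HasCoeffsIn ℒ (Set.Ioi 0) Ψp ∧
  ∃ Qm Q0 Qp : MvPowerSeries Var 𝔭,
    (HasCoeffsIn ℒ (Set.Iio 0) Qm ∧ OnlyMixedTerms Qm) ∧
    (HasCoeffsIn ℒ {0} Q0 ∧ OnlyMixedTerms Q0) ∧
    (HasCoeffsIn ℒ (Set.Ioi 0) Qp ∧ OnlyMixedTerms Qp) ∧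
    Ψm = gMinus q + Qm ∧ Ψ0 = Q0 ∧ Ψp = gPlus p + Qp

end Graded

end GradedUniformization

open GradedUniformization

/-! Existence comes from a differential equation in the ℬ-variables. Let E be the Euler derivation
multiplying each monomial by its ℬ-order, and look for Ψ⁻, Ψ⁰, Ψ⁺ as the three projections of a
single series Ψ. From E(e^f) = (∑ (ad f)^n (E f) / (n+1)!) e^f (`eulerB_expU`) and e^f h = (e^{ad f}
h) e^f (`expU_mul_toU`), both sides of the factorization satisfy E X = a X with a in 𝔭[[𝒜, ℬ]]. On
the left a is e^{ad g⁺} g⁻, because E g⁺ = 0 and E g⁻ = g⁻; on the right a is `logDeriv`, which is E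
Ψ plus iterated brackets. In characteristic zero a solution of E X = a X, with a free of constant
term, is determined by its part of ℬ-order zero (`eq_of_eulerB_eq_mul`). So it suffices to equate
the two values of a and to have Ψ = g⁺ in ℬ-order zero.

Inverting E turns this into a fixed-point equation for `picard`. There the unknown enters only
through brackets of series without constant term, and such a bracket is known to one degree more
than its entries; hence `picard` is a contraction in the degree-adic sense and has a fixed point
(`exists_fixedPoint_of_contraction`, `picard_eqMod_succ`). It is built from brackets, projections
and rescalings by functions of the ℬ-order, so all iterates from 0, and hence the fixed point, are
series of words. A word in g⁺ alone or g⁻ alone is zero or the letter itself, which makes every term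
of degree at least two mixed. Two applications of the contraction estimate give the terms of total
order at most two.

Uniqueness is by induction on the degree: modulo lower degrees, the product of the exponentials
determines the image of Ψ⁻ + Ψ⁰ + Ψ⁺ in U(𝔭), and the grading separates the summands. This requires
𝔭 → U(𝔭) to be injective (`UniversalEnvelopingAlgebra.ι_injective`), which is proved by a
diamond-lemma argument on words in a basis. -/

namespace UniversalEnvelopingAlgebra

/-! ### Normal forms of words in a basis of a Lie algebra -/

section NormalForm

variable {F L I M : Type*} [Field F] [LieRing L] [LieAlgebra F L] [AddCommGroup M] [Module F M]

/-- The linear extension of a function of words in one of the letters. -/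
noncomputable def slot (b : Module.Basis I F L) (N : List I → M) (u v : List I) : L →ₗ[F] M :=
  b.constr F fun k => N (u ++ k :: v)

@[simp]
theorem slot_basis (b : Module.Basis I F L) (N : List I → M) (u v : List I) (k : I) :
    slot b N u v (b k) = N (u ++ k :: v) :=
  b.constr_basis F _ k

/-- The value of `N` at the word `u a c v` is computed by exchanging the letters `a` and `c`. -/
def Exchange (b : Module.Basis I F L) (N : List I → M) (u : List I) (a c : I) (v : List I) : Prop :=
  N (u ++ a :: c :: v) = N (u ++ c :: a :: v) + slot b N u v ⁅b a, b c⁆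

theorem Exchange.symm {b : Module.Basis I F L} {N : List I → M} {u v : List I} {a c : I}
    (h : Exchange b N u a c v) : Exchange b N u c a v := by
  unfold Exchange at *
  rw [h, ← lie_skew, map_neg]
  abel

theorem exchange_self (b : Module.Basis I F L) (N : List I → M) (u v : List I) (a : I) :
    Exchange b N u a a v := by
  simp [Exchange]

/-- The exchange rule for two basis letters is linear in the first one, so that letter may be any x:
N(u x k v) - N(u k x v) = N(u [x, k] v). -/
theorem slot_sub_slot {b : Module.Basis I F L} {N : List I → M} {u v : List I}
    (h : ∀ a c, Exchange b N u a c v) (x : L) (k : I) :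
    slot b N u (k :: v) x - slot b N (u ++ [k]) v x = slot b N u v ⁅x, b k⁆ := by
  have e : slot b N u (k :: v) - slot b N (u ++ [k]) v
      = -(slot b N u v ∘ₗ (LieAlgebra.ad F L (b k))) := by
    refine b.ext fun a => ?_
    have := h a k
    unfold Exchange at this
    simp [this]
    rw [← lie_skew, map_neg]
  have := LinearMap.congr_fun e x
  simp only [LinearMap.sub_apply, LinearMap.neg_apply, LinearMap.comp_apply,
    LieAlgebra.ad_apply] at this
  rw [this, ← lie_skew, map_neg, neg_neg]

/-- The overlap ambiguity of the diamond lemma: u x y z v can be rewritten at x y or at y z.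
Carrying both rewritings on to z y x leaves a difference of bracket terms, which vanishes by the
Jacobi identity. -/
theorem exchange_overlap {b : Module.Basis I F L} {N : List I → M} {u v : List I} {x y z : I}
    (h : ∀ a c, Exchange b N u a c v)
    (h1 : Exchange b N (u ++ [y]) x z v) (h2 : Exchange b N u y z (x :: v))
    (h3 : Exchange b N u x z (y :: v)) (h4 : Exchange b N (u ++ [z]) x y v) :
    N (u ++ y :: x :: z :: v) + slot b N u (z :: v) ⁅b x, b y⁆ =
      N (u ++ x :: z :: y :: v) + slot b N (u ++ [x]) v ⁅b y, b z⁆ := by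
  simp only [Exchange, List.append_assoc, List.singleton_append] at h1 h2 h3 h4
  have e1 := slot_sub_slot h ⁅b y, b z⁆ x
  have e2 := slot_sub_slot h ⁅b x, b z⁆ y
  have e3 := slot_sub_slot h ⁅b x, b y⁆ z
  have j : slot b N u v ⁅⁅b y, b z⁆, b x⁆ - slot b N u v ⁅⁅b x, b z⁆, b y⁆
      + slot b N u v ⁅⁅b x, b y⁆, b z⁆ = 0 := by
    have e : ⁅⁅b y, b z⁆, b x⁆ - ⁅⁅b x, b z⁆, b y⁆ + ⁅⁅b x, b y⁆, b z⁆ = 0 := by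
      rw [lie_lie (b x) (b y) (b z), ← lie_skew ⁅b y, b z⁆, ← lie_skew ⁅b x, b z⁆]
      abel
    rw [← map_sub, ← map_add, e, map_zero]
  rw [← e1, ← e2, ← e3] at j
  rw [h1, h2, h3, h4, ← sub_eq_zero, ← j]
  abel

theorem slot_exchange {b : Module.Basis I F L} {N : List I → M} {u s v : List I} {a c : I}
    (h : ∀ k, Exchange b N (u ++ k :: s) a c v) (x : L) :
    slot b N u (s ++ a :: c :: v) x = slot b N u (s ++ c :: a :: v) x
      + b.constr F (fun k => slot b N (u ++ k :: s) v ⁅b a, b c⁆) x := by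
  rw [← LinearMap.add_apply]
  refine LinearMap.congr_fun (b.ext fun k => ?_) x
  have := h k
  simp only [Exchange, List.append_assoc, List.cons_append] at this
  simp [this]

theorem slot_exchange' {b : Module.Basis I F L} {N : List I → M} {u s v : List I} {a c : I}
    (h : ∀ k, Exchange b N u a c (s ++ k :: v)) (x : L) :
    slot b N (u ++ a :: c :: s) v x = slot b N (u ++ c :: a :: s) v x
      + b.constr F (fun k => slot b N u (s ++ k :: v) ⁅b a, b c⁆) x := by
  rw [← LinearMap.add_apply]
  refine LinearMap.congr_fun (b.ext fun k => ?_) x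
  have := h k
  simp only [Exchange] at this
  simp [this]

/-- Both sides are the bilinear extension of N to the word u x s y v, evaluated in the two possible
orders. -/
theorem constr_slot_comm (b : Module.Basis I F L) (N : List I → M) (u s v : List I) (x y : L) :
    b.constr F (fun k => slot b N (u ++ k :: s) v y) x =
      b.constr F (fun k => slot b N u (s ++ k :: v) x) y := by
  simp only [slot, Module.Basis.constr_apply, Finsupp.sum, Finset.smul_sum, List.append_assoc,
    List.cons_append]
  rw [Finset.sum_comm]
  exact Finset.sum_congr rfl fun _ _ => Finset.sum_congr rfl fun _ _ => smul_comm _ _ _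

/-- Rewritings at disjoint places commute: after performing both, the doubly bracketed term N(u [a,
c] s [a', c'] v) is the same in either order. -/
theorem exchange_disjoint {b : Module.Basis I F L} {N : List I → M} {u s v : List I}
    {a c a' c' : I}
    (h1 : ∀ k, Exchange b N (u ++ k :: s) a' c' v) (h2 : ∀ k, Exchange b N u a c (s ++ k :: v))
    (h3 : Exchange b N (u ++ c :: a :: s) a' c' v)
    (h4 : Exchange b N u a c (s ++ c' :: a' :: v)) :
    N (u ++ c :: a :: s ++ a' :: c' :: v) + slot b N u (s ++ a' :: c' :: v) ⁅b a, b c⁆ =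
      N (u ++ a :: c :: s ++ c' :: a' :: v) + slot b N (u ++ a :: c :: s) v ⁅b a', b c'⁆ := by
  simp only [Exchange, List.append_assoc, List.cons_append] at h3 h4 ⊢
  rw [h3, h4, slot_exchange h1, slot_exchange' h2, constr_slot_comm]
  abel

variable [LinearOrder I]

theorem exchange_of_lt {b : Module.Basis I F L} {N : List I → M} {u v : List I}
    (h : ∀ a c, c < a → Exchange b N u a c v) (a c : I) : Exchange b N u a c v := by
  rcases lt_trichotomy a c with h' | rfl | h'
  · exact (h c a h').symm
  · exact exchange_self b N u v a
  · exact h a c h'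

/-- The number of inversions of a word. -/
def inversions : List I → ℕ
  | [] => 0
  | a :: l => l.countP (· < a) + inversions l

theorem inversions_swap_lt (u v : List I) {a c : I} (h : c < a) :
    inversions (u ++ c :: a :: v) < inversions (u ++ a :: c :: v) := by
  induction u with
  | nil =>
    simp only [List.nil_append, inversions, List.countP_cons, h, not_lt_of_gt h]
    simp
    omega
  | cons d u ih =>
    have e : (u ++ c :: a :: v).countP (· < d) = (u ++ a :: c :: v).countP (· < d) :=
      ((List.Perm.swap a c v).append_left u).countP_eq _
    simp only [List.cons_append, inversions, e]
    omega

open Classical in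
/-- The linear part of the normal form of a word: letters are sorted by means of the rule
`a c = c a + [a, c]`, and sorted words other than single letters have linear part zero. -/
noncomputable def normalForm (b : Module.Basis I F L) (w : List I) : L :=
  if h : ∃ t : List I × I × I × List I, t.2.2.1 < t.2.1 ∧ w = t.1 ++ t.2.1 :: t.2.2.1 :: t.2.2.2 then
    normalForm b (h.choose.1 ++ h.choose.2.2.1 :: h.choose.2.1 :: h.choose.2.2.2) +
      b.constr F (fun k => normalForm b (h.choose.1 ++ k :: h.choose.2.2.2))
        ⁅b h.choose.2.1, b h.choose.2.2.1⁆
  else match w with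
    | [k] => b k
    | _ => 0
-- Lexicographic order: the exchange keeps the length and removes an inversion, while the bracket
-- term is shorter.
termination_by (w.length, inversions w)
decreasing_by
  · obtain ⟨h1, h2⟩ := h.choose_spec
    have e := congrArg List.length h2
    have e' := congrArg inversions h2
    have := inversions_swap_lt h.choose.1 h.choose.2.2.2 h1
    rw [Prod.lex_def]
    right
    constructor
    · simp only [e]
      simp
    · simp only [e']
      exact this
  · have e := congrArg List.length h.choose_spec.2
    rw [Prod.lex_def]
    left
    simp only [e]
    simp

theorem normalForm_singleton (b : Module.Basis I F L) (k : I) : normalForm b [k] = b k := by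
  rw [normalForm, dif_neg]
  rintro ⟨⟨u, a, c, v⟩, -, h⟩
  have := congrArg List.length h
  simp at this
  omega

/-- The recursion rewrites at one chosen descent, which need not be the given one; confluence
bridges the difference. -/
theorem exists_normalForm_eq (b : Module.Basis I F L) (u v : List I) {a c : I} (h : c < a) :
    ∃ u' a' c' v', c' < a' ∧ u ++ a :: c :: v = u' ++ a' :: c' :: v' ∧
      Exchange b (normalForm b) u' a' c' v' := by
  have hw : ∃ t : List I × I × I × List I, t.2.2.1 < t.2.1 ∧
      u ++ a :: c :: v = t.1 ++ t.2.1 :: t.2.2.1 :: t.2.2.2 := ⟨(u, a, c, v), h, rfl⟩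
  refine ⟨_, _, _, _, hw.choose_spec.1, hw.choose_spec.2, ?_⟩
  rw [Exchange, ← hw.choose_spec.2]
  conv_lhs => rw [normalForm, dif_pos hw]
  rfl

/-- Two descents of a word coincide, overlap in one letter or are disjoint. The last two cases are
`exchange_overlap` and `exchange_disjoint`, whose hypotheses concern words that are shorter or have
fewer inversions. -/
theorem normalForm_confluent (b : Module.Basis I F L) {u v u' v' : List I} {a c a' c' : I}
    (h : c < a) (h' : c' < a') (e : u ++ a :: c :: v = u' ++ a' :: c' :: v')
    (ih : ∀ (x y : List I) (d f : I), f < d →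
      ((x ++ d :: f :: y).length < (u ++ a :: c :: v).length ∨
        (x ++ d :: f :: y).length = (u ++ a :: c :: v).length ∧
          inversions (x ++ d :: f :: y) < inversions (u ++ a :: c :: v)) →
      Exchange b (normalForm b) x d f y)
    (hl : u.length ≤ u'.length) :
    normalForm b (u ++ c :: a :: v) + slot b (normalForm b) u v ⁅b a, b c⁆ =
      normalForm b (u' ++ c' :: a' :: v') + slot b (normalForm b) u' v' ⁅b a', b c'⁆ := by
  have ih1 : ∀ (x y : List I), x.length + y.length < u.length + v.length → ∀ d f,
      Exchange b (normalForm b) x d f y := fun x y hxy =>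
    exchange_of_lt fun d f hdf => ih x y d f hdf (Or.inl (by simp; omega))
  rw [List.append_eq_append_iff] at e
  rcases e with ⟨s, rfl, e⟩ | ⟨s, rfl, e⟩
  · match s, e with
    | [], e => simp at e; obtain ⟨rfl, rfl, rfl⟩ := e; simp
    -- Overlap: the word is u a c c' v' with c' < c < a.
    | [d], e =>
      simp at e; obtain ⟨rfl, rfl, rfl⟩ := e
      have h3 := inversions_swap_lt u (c' :: v') h
      have h4 := inversions_swap_lt (u ++ [a]) v' h'
      have h5 := inversions_swap_lt (u ++ [c]) v' (h'.trans h)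
      have h6 := inversions_swap_lt u (c :: v') (h'.trans h)
      simp only [List.append_assoc, List.singleton_append] at h3 h4 h5 h6
      have := exchange_overlap (b := b) (N := normalForm b) (u := u) (v := v')
        (x := a) (y := c) (z := c') (ih1 u v' (by simp))
        (ih _ _ _ _ (h'.trans h) (Or.inr ⟨by simp, by simpa using h3⟩))
        (ih _ _ _ _ h' (Or.inr ⟨by simp, by omega⟩))
        (ih _ _ _ _ (h'.trans h) (Or.inr ⟨by simp, by omega⟩))
        (ih _ _ _ _ h (Or.inr ⟨by simp, by simp; omega⟩))
      simpa using this
    | d :: f :: s, e =>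
      simp at e; obtain ⟨rfl, rfl, rfl⟩ := e
      have h3 := inversions_swap_lt u (s ++ a' :: c' :: v') h
      have h4 := inversions_swap_lt (u ++ a :: c :: s) v' h'
      simp only [List.append_assoc, List.cons_append] at h3 h4
      have := exchange_disjoint (b := b) (N := normalForm b) (u := u) (s := s) (v := v')
        (a := a) (c := c) (a' := a') (c' := c')
        (fun k => ih1 _ _ (by simp; omega) _ _) (fun k => ih1 _ _ (by simp; try omega) _ _)
        (ih _ _ _ _ h' (Or.inr ⟨by simp, by simpa using h3⟩))
        (ih _ _ _ _ h (Or.inr ⟨by simp, by simpa using h4⟩))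
      simpa using this
  · have : s = [] := by
      simpa using hl
    subst this
    simp at e; obtain ⟨rfl, rfl, rfl⟩ := e; simp

/-- Lexicographic induction on length and number of inversions: the rule holds by definition at the
chosen descent, and confluence transports it to every other one. -/
theorem normalForm_exchange (b : Module.Basis I F L) (u : List I) (a c : I) (v : List I) :
    Exchange b (normalForm b) u a c v := by
  suffices H : ∀ (n m : ℕ) (u : List I) (a c : I) (v : List I), c < a →
      (u ++ a :: c :: v).length = n → inversions (u ++ a :: c :: v) = m →
      Exchange b (normalForm b) u a c v from
    exchange_of_lt (fun a c h => H _ _ u a c v h rfl rfl) a c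
  intro n
  induction n using Nat.strong_induction_on with | _ n ihn
  intro m
  induction m using Nat.strong_induction_on with | _ m ihm
  intro u a c v h hn hm
  have ih : ∀ (x y : List I) (d f : I), f < d →
      ((x ++ d :: f :: y).length < (u ++ a :: c :: v).length ∨
        (x ++ d :: f :: y).length = (u ++ a :: c :: v).length ∧
          inversions (x ++ d :: f :: y) < inversions (u ++ a :: c :: v)) →
      Exchange b (normalForm b) x d f y := by
    rintro x y d f hdf (hlt | ⟨heq, hlt⟩)
    · exact ihn _ (hn ▸ hlt) _ _ _ _ _ hdf rfl rfl
    · exact ihm _ (hm ▸ hlt) _ _ _ _ hdf (heq.trans hn) rfl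
  obtain ⟨u', a', c', v', h', e, hE⟩ := exists_normalForm_eq b u v h
  unfold Exchange at hE ⊢
  rw [e, hE]
  rcases le_total u.length u'.length with hl | hl
  · exact (normalForm_confluent b h h' e ih hl).symm
  · rw [e] at ih
    exact normalForm_confluent b h' h e.symm ih hl

end NormalForm

/-! ### Injectivity of the map to the enveloping algebra -/

section Injective

attribute [local instance] LieRing.ofAssociativeRing

variable {F L I : Type*} [Field F] [LieRing L] [LieAlgebra F L]

/-- The functions of words that are compatible with the commutation relations. -/
def exchangeSubmodule (b : Module.Basis I F L) : Submodule F (List I → L) where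
  carrier := {N | ∀ u a c v, Exchange b N u a c v}
  zero_mem' u a c v := by
    have e : slot b (0 : List I → L) u v = 0 := b.ext fun k => by simp
    simp [Exchange, e]
  add_mem' {N N'} h h' u a c v := by
    have e : slot b (N + N') u v = slot b N u v + slot b N' u v := b.ext fun k => by simp
    have h1 := h u a c v
    have h2 := h' u a c v
    simp only [Exchange, Pi.add_apply, e, LinearMap.add_apply] at *
    rw [h1, h2]
    abel
  smul_mem' r N h u a c v := by
    have e : slot b (r • N) u v = r • slot b N u v := b.ext fun k => by simp
    have h1 := h u a c v
    simp only [Exchange, Pi.smul_apply, e, LinearMap.smul_apply] at *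
    rw [h1, smul_add]

/-- This makes right translation a representation: N(w x y) - N(w y x) = N(w [x, y]), where x and y
are now arbitrary elements rather than letters. -/
theorem slot_lie {b : Module.Basis I F L} {N : List I → L}
    (h : ∀ u a c v, Exchange b N u a c v) (w : List I) (x y : L) :
    slot b N w [] ⁅x, y⁆ = slot b (fun w' => slot b N w' [] y) w [] x
      - slot b (fun w' => slot b N w' [] x) w [] y := by
  have e : slot b (fun w' => slot b N w' [] x) w [] y
      = b.constr F (fun k => slot b N w [k] y) x := by
    simpa [slot] using constr_slot_comm b N w [] [] y x
  rw [e, ← lie_skew, map_neg]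
  have e2 : -(slot b N w [] ∘ₗ LieAlgebra.ad F L y)
      = slot b (fun w' => slot b N w' [] y) w [] - b.constr F (fun k => slot b N w [k] y) := by
    refine b.ext fun k => ?_
    have := slot_sub_slot (h w · · []) y k
    simp [← this]
  simpa using LinearMap.congr_fun e2 x

/-- Right translation of functions of words by elements of the Lie algebra. -/
noncomputable def translate (b : Module.Basis I F L) :
    L →ₗ⁅F⁆ Module.End F (exchangeSubmodule b) where
  toFun x :=
    { toFun := fun N => ⟨fun w => slot b N.1 w [] x, fun u a c v => by
        change slot b N.1 _ [] x = slot b N.1 _ [] x + slot b (fun w => slot b N.1 w [] x) u v _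
        have e1 := slot_exchange' (b := b) (N := N.1) (u := u) (s := v) (v := []) (a := a) (c := c)
          (fun k => N.2 _ _ _ _) x
        rw [e1]
        congr 1
        exact constr_slot_comm b N.1 u v [] _ _ |>.symm⟩
      map_add' := fun N N' => by
        have e : ∀ w, slot b (N.1 + N'.1) w [] = slot b N.1 w [] + slot b N'.1 w [] :=
          fun w => b.ext fun k => by simp
        ext w
        simp [e]
      map_smul' := fun r N => by
        have e : ∀ w, slot b (r • N.1) w [] = r • slot b N.1 w [] :=
          fun w => b.ext fun k => by simp
        ext w
        simp [e] }
  map_add' x y := by ext; simp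
  map_smul' r x := by ext; simp
  map_lie' {x y} := by
    ext N w
    exact slot_lie N.2 w x y

/-- The representation `translate` factors through the enveloping algebra, and translating
`normalForm` by x and evaluating at the empty word returns x. -/
theorem ι_injective_of_basis [LinearOrder I] (b : Module.Basis I F L) :
    Function.Injective (ι F : L →ₗ⁅F⁆ UniversalEnvelopingAlgebra F L) := by
  rw [injective_iff_map_eq_zero]
  intro x hx
  have h : translate b x = 0 := by
    rw [← lift_ι_apply F (translate b) x, hx, map_zero]
  have h' := congrArg (fun f => (f ⟨normalForm b, normalForm_exchange b⟩).1 []) h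
  have e : slot b (normalForm b) [] [] = LinearMap.id := b.ext fun k => by
    simp [normalForm_singleton]
  simpa [translate, e] using h'

variable (F L) in
/-- A consequence of the Poincaré–Birkhoff–Witt theorem. -/
theorem ι_injective : Function.Injective (ι F : L →ₗ⁅F⁆ UniversalEnvelopingAlgebra F L) := by
  let b := Module.Basis.ofVectorSpace F L
  classical
  let _ : LinearOrder (Module.Basis.ofVectorSpaceIndex F L) := linearOrderOfSTO WellOrderingRel
  exact ι_injective_of_basis b

end Injective

end UniversalEnvelopingAlgebra

namespace GradedUniformization

open Finset.HasAntidiagonal (antidiagonal mem_antidiagonal)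

/-! ### Congruence of power series modulo high degree -/

section Congruence

variable {σ V W X : Type*}

/-- Two series agree in all degrees less than `N`. -/
def EqMod (N : ℕ) (f g : MvPowerSeries σ V) : Prop :=
  ∀ d : σ →₀ ℕ, d.degree < N → f d = g d

theorem EqMod.refl (N : ℕ) (f : MvPowerSeries σ V) : EqMod N f f := fun _ _ => rfl

theorem EqMod.symm {N : ℕ} {f g : MvPowerSeries σ V} (h : EqMod N f g) : EqMod N g f :=
  fun d hd => (h d hd).symm

theorem EqMod.trans {N : ℕ} {f g k : MvPowerSeries σ V} (h : EqMod N f g) (h' : EqMod N g k) :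
    EqMod N f k :=
  fun d hd => (h d hd).trans (h' d hd)

theorem EqMod.mono {M N : ℕ} {f g : MvPowerSeries σ V} (h : EqMod N f g) (hMN : M ≤ N) :
    EqMod M f g :=
  fun d hd => h d (hd.trans_le hMN)

theorem eq_of_forall_eqMod {f g : MvPowerSeries σ V} (h : ∀ N, EqMod N f g) : f = g :=
  funext fun d => h (d.degree + 1) d (Nat.lt_succ_self _)

theorem eqMod_one_iff [Zero V] {f : MvPowerSeries σ V} : EqMod 1 f 0 ↔ f 0 = 0 := by
  refine ⟨fun h => h 0 (by simp), fun h d hd => ?_⟩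
  rw [Nat.lt_one_iff, Finsupp.degree_eq_zero_iff] at hd
  rw [hd, h]
  rfl

section AddCommGroup

variable [AddCommGroup V] [AddCommGroup W] [AddCommGroup X]

@[simp] theorem series_zero_apply (d : σ →₀ ℕ) : (0 : MvPowerSeries σ V) d = 0 := rfl

@[simp] theorem series_add_apply (f g : MvPowerSeries σ V) (d : σ →₀ ℕ) :
    (f + g) d = f d + g d := rfl

@[simp] theorem series_sub_apply (f g : MvPowerSeries σ V) (d : σ →₀ ℕ) :
    (f - g) d = f d - g d := rfl

@[simp] theorem series_smul_apply {F : Type*} [Semiring F] [Module F V] (c : F)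
    (f : MvPowerSeries σ V) (d : σ →₀ ℕ) : (c • f) d = c • f d := rfl

@[simp] theorem series_sum_apply {ι : Type*} (s : Finset ι) (f : ι → MvPowerSeries σ V)
    (d : σ →₀ ℕ) : (∑ i ∈ s, f i) d = ∑ i ∈ s, f i d :=
  Finset.sum_apply d s f

theorem EqMod.add {N : ℕ} {f f' g g' : MvPowerSeries σ V} (h : EqMod N f f') (h' : EqMod N g g') :
    EqMod N (f + g) (f' + g') := fun d hd => by simp [h d hd, h' d hd]

theorem EqMod.sub {N : ℕ} {f f' g g' : MvPowerSeries σ V} (h : EqMod N f f') (h' : EqMod N g g') :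
    EqMod N (f - g) (f' - g') := fun d hd => by simp [h d hd, h' d hd]

theorem EqMod.smul {F : Type*} [Semiring F] [Module F V] {N : ℕ} {f f' : MvPowerSeries σ V} (c : F)
    (h : EqMod N f f') : EqMod N (c • f) (c • f') := fun d hd => by simp [h d hd]

variable [DecidableEq σ]

omit [AddCommGroup V] [AddCommGroup W] in
theorem sum_antidiagonal_eqMod (B : V → W → X) {N : ℕ} {f f' : MvPowerSeries σ V}
    {g g' : MvPowerSeries σ W} (hf : EqMod N f f') (hg : EqMod N g g') :
    EqMod N (fun d => ∑ ab ∈ antidiagonal d, B (f ab.1) (g ab.2) : MvPowerSeries σ X)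
      (fun d => ∑ ab ∈ antidiagonal d, B (f' ab.1) (g' ab.2)) := by
  intro d hd
  refine Finset.sum_congr rfl fun ab hab => ?_
  rw [mem_antidiagonal] at hab
  have := congrArg Finsupp.degree hab
  rw [map_add] at this
  rw [hf _ (by omega), hg _ (by omega)]

/-- Without constant terms, each factor in a nonzero product has positive degree, so a coefficient
of degree N involves only coefficients of degree less than N. This gain of one degree drives both
the contraction and the uniqueness argument. -/
theorem sum_antidiagonal_eqMod_succ (B : V → W → X) (hl : ∀ y, B 0 y = 0) (hr : ∀ x, B x 0 = 0)
    {N : ℕ} {f f' : MvPowerSeries σ V} {g g' : MvPowerSeries σ W}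
    (hf0 : EqMod 1 f 0) (hf0' : EqMod 1 f' 0) (hg0 : EqMod 1 g 0) (hg0' : EqMod 1 g' 0)
    (hf : EqMod N f f') (hg : EqMod N g g') :
    EqMod (N + 1) (fun d => ∑ ab ∈ antidiagonal d, B (f ab.1) (g ab.2) : MvPowerSeries σ X)
      (fun d => ∑ ab ∈ antidiagonal d, B (f' ab.1) (g' ab.2)) := by
  intro d hd
  refine Finset.sum_congr rfl fun ab hab => ?_
  rw [mem_antidiagonal] at hab
  have := congrArg Finsupp.degree hab
  rw [map_add] at this
  by_cases h1 : ab.1.degree = 0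
  · rw [hf0 _ (by omega), hf0' _ (by omega), series_zero_apply, hl, hl]
  by_cases h2 : ab.2.degree = 0
  · rw [hg0 _ (by omega), hg0' _ (by omega), series_zero_apply, hr, hr]
  rw [hf _ (by omega), hg _ (by omega)]

theorem sum_antidiagonal_eqMod_zero (B : V → W → X) (hl : ∀ y, B 0 y = 0) (hr : ∀ x, B x 0 = 0)
    {m n : ℕ} {f : MvPowerSeries σ V} {g : MvPowerSeries σ W}
    (hf : EqMod m f 0) (hg : EqMod n g 0) :
    EqMod (m + n)
      (fun d => ∑ ab ∈ antidiagonal d, B (f ab.1) (g ab.2) : MvPowerSeries σ X) 0 := by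
  intro d hd
  refine Finset.sum_eq_zero fun ab hab => ?_
  rw [mem_antidiagonal] at hab
  have := congrArg Finsupp.degree hab
  rw [map_add] at this
  by_cases h1 : ab.1.degree < m
  · rw [hf _ h1, series_zero_apply, hl]
  · rw [hg _ (by omega), series_zero_apply, hr]

end AddCommGroup

section Ring

variable {A : Type*} [Ring A]

theorem series_mul_apply [DecidableEq σ] (f g : MvPowerSeries σ A) (d : σ →₀ ℕ) :
    (f * g) d = ∑ ab ∈ antidiagonal d, f ab.1 * g ab.2 :=
  MvPowerSeries.coeff_mul d f g

theorem series_mul_eq [DecidableEq σ] (f g : MvPowerSeries σ A) :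
    f * g = fun d => ∑ ab ∈ antidiagonal d, f ab.1 * g ab.2 :=
  funext fun d => series_mul_apply f g d

theorem EqMod.mul {N : ℕ} {f f' g g' : MvPowerSeries σ A} (hf : EqMod N f f') (hg : EqMod N g g') :
    EqMod N (f * g) (f' * g') := by
  classical
  rw [series_mul_eq, series_mul_eq]
  exact sum_antidiagonal_eqMod (fun x y : A => x * y) hf hg

theorem EqMod.mul_succ {N : ℕ} {f f' g g' : MvPowerSeries σ A} (hf0 : EqMod 1 f 0)
    (hf0' : EqMod 1 f' 0) (hg0 : EqMod 1 g 0) (hg0' : EqMod 1 g' 0)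
    (hf : EqMod N f f') (hg : EqMod N g g') : EqMod (N + 1) (f * g) (f' * g') := by
  classical
  rw [series_mul_eq, series_mul_eq]
  exact sum_antidiagonal_eqMod_succ (fun x y : A => x * y) zero_mul mul_zero hf0 hf0' hg0 hg0' hf hg

theorem EqMod.mul_zero {m n : ℕ} {f g : MvPowerSeries σ A} (hf : EqMod m f 0) (hg : EqMod n g 0) :
    EqMod (m + n) (f * g) 0 := by
  classical
  rw [series_mul_eq]
  exact sum_antidiagonal_eqMod_zero (fun x y : A => x * y) zero_mul MulZeroClass.mul_zero hf hg

theorem EqMod.pow_zero {f : MvPowerSeries σ A} (hf : EqMod 1 f 0) (k : ℕ) : EqMod k (f ^ k) 0 := by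
  induction k with
  | zero => exact fun d hd => absurd hd (Nat.not_lt_zero _)
  | succ k ih => rw [pow_succ]; exact ih.mul_zero hf

end Ring

section Lie

variable {L : Type*} [LieRing L]

theorem series_lie_apply [DecidableEq σ] (f g : MvPowerSeries σ L) (d : σ →₀ ℕ) :
    ⁅f, g⁆ d = ∑ ab ∈ antidiagonal d, ⁅f ab.1, g ab.2⁆ := by
  change serBracket f g d = _
  unfold serBracket
  congr!

theorem series_lie_eq [DecidableEq σ] (f g : MvPowerSeries σ L) :
    ⁅f, g⁆ = (fun d => ∑ ab ∈ antidiagonal d, ⁅f ab.1, g ab.2⁆ : MvPowerSeries σ L) :=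
  funext fun d => series_lie_apply f g d

theorem EqMod.lie_succ {N : ℕ} {f f' g g' : MvPowerSeries σ L} (hf0 : EqMod 1 f 0)
    (hf0' : EqMod 1 f' 0) (hg0 : EqMod 1 g 0) (hg0' : EqMod 1 g' 0)
    (hf : EqMod N f f') (hg : EqMod N g g') : EqMod (N + 1) ⁅f, g⁆ ⁅f', g'⁆ := by
  classical
  rw [series_lie_eq, series_lie_eq]
  exact sum_antidiagonal_eqMod_succ (fun x y : L => ⁅x, y⁆) zero_lie lie_zero hf0 hf0' hg0 hg0' hf hg

theorem EqMod.lie_zero {m n : ℕ} {f g : MvPowerSeries σ L} (hf : EqMod m f 0) (hg : EqMod n g 0) :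
    EqMod (m + n) ⁅f, g⁆ 0 := by
  classical
  rw [series_lie_eq]
  exact sum_antidiagonal_eqMod_zero (fun x y : L => ⁅x, y⁆) zero_lie _root_.lie_zero hf hg

end Lie

end Congruence

/-! ### Locally finite sums and formal exponentials -/

section LocallyFiniteSum

variable {σ V : Type*} [AddCommGroup V]

/-- The sum of a sequence of series, the `n`-th of which has no terms of degree less than `n`. -/
noncomputable def lsum (s : ℕ → MvPowerSeries σ V) : MvPowerSeries σ V :=
  fun d => ∑ n ∈ Finset.range (d.degree + 1), s n d

theorem lsum_apply {s : ℕ → MvPowerSeries σ V} (hs : ∀ n, EqMod n (s n) 0) {d : σ →₀ ℕ} {K : ℕ}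
    (hK : d.degree < K) : lsum s d = ∑ n ∈ Finset.range K, s n d := by
  refine Finset.sum_subset (fun n hn => ?_) fun n _ hn => ?_
  · rw [Finset.mem_range] at hn ⊢; omega
  · rw [Finset.mem_range] at hn
    exact hs n d (by omega)

theorem lsum_congr {s t : ℕ → MvPowerSeries σ V} (h : ∀ n, s n = t n) : lsum s = lsum t :=
  congrArg lsum (funext h)

theorem lsum_shift {s : ℕ → MvPowerSeries σ V} (hs : ∀ n, EqMod n (s n) 0) (h0 : s 0 = 0) :
    lsum s = lsum fun n => s (n + 1) := by
  funext d
  rw [lsum_apply hs (K := d.degree + 1 + 1) (by omega), Finset.sum_range_succ', h0,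
    series_zero_apply, add_zero]
  rfl

theorem lsum_eqMod {s t : ℕ → MvPowerSeries σ V} {N : ℕ} (h : ∀ n, EqMod N (s n) (t n)) :
    EqMod N (lsum s) (lsum t) :=
  fun d hd => Finset.sum_congr rfl fun n _ => h n d hd

variable {A : Type*} [Ring A]

theorem lsum_mul {s : ℕ → MvPowerSeries σ A} (hs : ∀ n, EqMod n (s n) 0) (g : MvPowerSeries σ A) :
    lsum s * g = lsum fun n => s n * g := by
  classical
  funext d
  simp only [series_mul_apply, lsum]
  rw [Finset.sum_comm]
  refine Finset.sum_congr rfl fun ab hab => ?_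
  rw [← Finset.sum_mul]
  congr 1
  have := congrArg Finsupp.degree (mem_antidiagonal.1 hab)
  rw [map_add] at this
  exact lsum_apply hs (by omega)

theorem lsum_mul_lsum {s t : ℕ → MvPowerSeries σ A} (hs : ∀ n, EqMod n (s n) 0)
    (ht : ∀ n, EqMod n (t n) 0) :
    lsum s * lsum t = lsum fun n => ∑ ij ∈ antidiagonal n, s ij.1 * t ij.2 := by
  classical
  funext d
  have e1 : (lsum s * lsum t) d = ∑ i ∈ Finset.range (d.degree + 1),
      ∑ j ∈ Finset.range (d.degree + 1), (s i * t j) d := by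
    simp only [series_mul_apply]
    have : ∀ ab ∈ antidiagonal d, lsum s ab.1 * lsum t ab.2 =
        ∑ i ∈ Finset.range (d.degree + 1), ∑ j ∈ Finset.range (d.degree + 1),
          s i ab.1 * t j ab.2 := by
      intro ab hab
      have := congrArg Finsupp.degree (mem_antidiagonal.1 hab)
      rw [map_add] at this
      rw [lsum_apply hs (K := d.degree + 1) (by omega),
        lsum_apply ht (K := d.degree + 1) (by omega), Finset.sum_mul_sum]
    rw [Finset.sum_congr rfl this, Finset.sum_comm]
    exact Finset.sum_congr rfl fun i _ => Finset.sum_comm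
  rw [e1]
  simp only [lsum, series_sum_apply]
  rw [← Finset.sum_product', Finset.sum_sigma']
  symm
  -- The pairs on the antidiagonals form a triangle inside the square; the remaining pairs have i +
  -- j greater than the degree of d and contribute zero.
  refine Finset.sum_of_injOn (fun x => x.2) ?_ ?_ ?_ ?_
  · rintro ⟨n, i, j⟩ h ⟨n', i', j'⟩ h' e
    simp at h h' e
    obtain ⟨rfl, rfl⟩ := e
    obtain ⟨-, rfl⟩ := h
    obtain ⟨-, rfl⟩ := h'
    rfl
  · rintro ⟨n, i, j⟩ h
    simp at h ⊢
    omega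
  · rintro ⟨i, j⟩ h h'
    have : d.degree < i + j := by
      by_contra hc
      exact h' ⟨⟨i + j, i, j⟩, by simp; omega, rfl⟩
    exact ((hs i).mul_zero (ht j)) d this
  · intro x _
    rfl

end LocallyFiniteSum

section Exponential

variable {F A : Type*} [Field F] [Ring A] [Algebra F A]

theorem EqMod.expDefined {f : MvPowerSeries Var A} (hf : EqMod 1 f 0) : ExpDefined f := fun d =>
  (Set.finite_Iic d.degree).subset fun k hk => by
    by_contra h
    exact hk ((hf.pow_zero k) d (by simpa using h))

theorem formalExp_eq_lsum {f : MvPowerSeries Var A} (hf : EqMod 1 f 0) :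
    formalExp F f = lsum fun k => ((k.factorial : F)⁻¹) • f ^ k := by
  funext d
  refine finsum_eq_sum_of_support_subset _ fun k hk => ?_
  rw [Finset.coe_range, Set.mem_Iio, Nat.lt_succ_iff]
  by_contra h
  refine hk ?_
  change ((k.factorial : F)⁻¹) • (f ^ k) d = 0
  rw [(hf.pow_zero k) d (by simpa using h), series_zero_apply, smul_zero]

theorem exp_terms_eqMod {f : MvPowerSeries Var A} (hf : EqMod 1 f 0) (k : ℕ) :
    EqMod k (((k.factorial : F)⁻¹) • f ^ k) 0 := by
  simpa using (hf.pow_zero k).smul ((k.factorial : F)⁻¹)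

end Exponential

/-! ### Power series in the adjoint action -/

section AdSeries

variable {F L : Type*} [Field F] [LieRing L] [LieAlgebra F L] {σ : Type*}

/-- The iterated bracket `[Ψ, [Ψ, …, [Ψ, h]]]`. -/
noncomputable def adPow (Ψ h : MvPowerSeries σ L) : ℕ → MvPowerSeries σ L
  | 0 => h
  | n + 1 => ⁅Ψ, adPow Ψ h n⁆

/-- The series `∑ n, c n • (ad Ψ)^n h`. -/
noncomputable def adSeries (c : ℕ → F) (Ψ h : MvPowerSeries σ L) : MvPowerSeries σ L :=
  lsum fun n => c n • adPow Ψ h n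

theorem adPow_eqMod_zero {Ψ h : MvPowerSeries σ L} {k : ℕ} (hΨ : EqMod 1 Ψ 0) (hh : EqMod k h 0)
    (n : ℕ) : EqMod (n + k) (adPow Ψ h n) 0 := by
  induction n with
  | zero => simpa [adPow] using hh
  | succ n ih => exact (hΨ.lie_zero ih).mono (by omega)

theorem adSeries_terms_eqMod (c : ℕ → F) {Ψ h : MvPowerSeries σ L} (hΨ : EqMod 1 Ψ 0) (n : ℕ) :
    EqMod n (c n • adPow Ψ h n) 0 := by
  simpa using (adPow_eqMod_zero hΨ (k := 0) (fun d hd => absurd hd (Nat.not_lt_zero _)) n).smul (c n)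

theorem adPow_succ_eqMod {Ψ Ψ' h h' : MvPowerSeries σ L} {N : ℕ} (hΨ0 : EqMod 1 Ψ 0)
    (hΨ0' : EqMod 1 Ψ' 0) (hh0 : EqMod 1 h 0) (hh0' : EqMod 1 h' 0) (hΨ : EqMod N Ψ Ψ')
    (hh : EqMod N h h') (n : ℕ) : EqMod (N + 1) (adPow Ψ h (n + 1)) (adPow Ψ' h' (n + 1)) := by
  induction n with
  | zero => exact EqMod.lie_succ hΨ0 hΨ0' hh0 hh0' hΨ hh
  | succ n ih =>
    exact EqMod.lie_succ hΨ0 hΨ0' ((adPow_eqMod_zero hΨ0 hh0 _).mono (by omega))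
      ((adPow_eqMod_zero hΨ0' hh0' _).mono (by omega)) hΨ (ih.mono (by omega))

theorem adSeries_zero (c : ℕ → F) (Ψ : MvPowerSeries σ L) : adSeries c Ψ 0 = 0 := by
  have : ∀ n, adPow Ψ 0 n = 0 := fun n => by
    induction n with
    | zero => rfl
    | succ n ih => rw [adPow, ih, lie_zero]
  funext d
  simp [adSeries, lsum, this]

theorem adSeries_self {c : ℕ → F} (hc : c 0 = 1) (h : MvPowerSeries σ L) :
    adSeries c h h = h := by
  have : ∀ n, adPow h h (n + 1) = 0 := fun n => by
    induction n with
    | zero => exact lie_self h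
    | succ n ih => rw [adPow, ih, lie_zero]
  funext d
  simp only [adSeries, lsum, Finset.sum_range_succ' _ d.degree, series_smul_apply, this]
  simp [adPow, hc]

/-- As c 0 = 1, subtracting h removes the only term that is not a bracket; every other term gains a
degree. -/
theorem adSeries_sub_eqMod {c : ℕ → F} (hc : c 0 = 1) {Ψ Ψ' h h' : MvPowerSeries σ L} {N : ℕ}
    (hΨ0 : EqMod 1 Ψ 0) (hΨ0' : EqMod 1 Ψ' 0) (hh0 : EqMod 1 h 0) (hh0' : EqMod 1 h' 0)
    (hΨ : EqMod N Ψ Ψ') (hh : EqMod N h h') :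
    EqMod (N + 1) (adSeries c Ψ h - h) (adSeries c Ψ' h' - h') := by
  intro d hd
  simp only [adSeries, lsum, series_sub_apply, Finset.sum_range_succ' _ d.degree, adPow, hc,
    one_smul, add_sub_cancel_right]
  exact Finset.sum_congr rfl fun n _ =>
    ((adPow_succ_eqMod hΨ0 hΨ0' hh0 hh0' hΨ hh n).smul (c (n + 1))) d hd

theorem adSeries_eqMod {c : ℕ → F} (hc : c 0 = 1) {Ψ Ψ' h h' : MvPowerSeries σ L} {N : ℕ}
    (hΨ0 : EqMod 1 Ψ 0) (hΨ0' : EqMod 1 Ψ' 0) (hh0 : EqMod 1 h 0) (hh0' : EqMod 1 h' 0)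
    (hΨ : EqMod N Ψ Ψ') (hh : EqMod N h h') : EqMod N (adSeries c Ψ h) (adSeries c Ψ' h') := by
  have := ((adSeries_sub_eqMod hc hΨ0 hΨ0' hh0 hh0' hΨ hh).mono (Nat.le_succ N)).add hh
  simpa using this

theorem adSeries_eqMod_zero (c : ℕ → F) {Ψ h : MvPowerSeries σ L} {k : ℕ}
    (hΨ0 : EqMod 1 Ψ 0) (hh0 : EqMod k h 0) : EqMod k (adSeries c Ψ h) 0 := by
  intro d hd
  change ∑ n ∈ Finset.range (d.degree + 1), (c n • adPow Ψ h n) d = 0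
  refine Finset.sum_eq_zero fun n _ => ?_
  rw [series_smul_apply, (adPow_eqMod_zero hΨ0 hh0 n) d (by omega), series_zero_apply, smul_zero]

end AdSeries

/-! ### Orders of monomials and the Euler derivation -/

section Orders

theorem orderA_add (d e : Mon) : orderA (d + e) = orderA d + orderA e :=
  Finsupp.sum_add_index' (fun v => by cases v <;> rfl) fun v m n => by cases v <;> rfl

theorem orderB_add (d e : Mon) : orderB (d + e) = orderB d + orderB e :=
  Finsupp.sum_add_index' (fun v => by cases v <;> rfl) fun v m n => by cases v <;> rfl

theorem orderA_add_orderB (d : Mon) : orderA d + orderB d = d.degree := by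
  rw [orderA, orderB, ← Finsupp.sum_add]
  exact Finset.sum_congr rfl fun v _ => by cases v <;> simp

end Orders

section Euler

/-- The Euler derivation in the variables `ℬ_j`. -/
def eulerB {V : Type*} [AddCommGroup V] (f : MvPowerSeries Var V) : MvPowerSeries Var V :=
  fun d => orderB d • f d

section Additive

variable {V : Type*} [AddCommGroup V]

@[simp] theorem eulerB_apply (f : MvPowerSeries Var V) (d : Mon) : eulerB f d = orderB d • f d :=
  rfl

theorem eulerB_zero : eulerB (0 : MvPowerSeries Var V) = 0 :=
  funext fun d => by simp

theorem eulerB_add (f g : MvPowerSeries Var V) : eulerB (f + g) = eulerB f + eulerB g :=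
  funext fun d => by simp

theorem eulerB_smul {F : Type*} [Semiring F] [Module F V] (c : F) (f : MvPowerSeries Var V) :
    eulerB (c • f) = c • eulerB f :=
  funext fun d => (smul_comm c (orderB d) (f d)).symm

theorem eulerB_lsum (s : ℕ → MvPowerSeries Var V) :
    eulerB (lsum s) = lsum fun n => eulerB (s n) :=
  funext fun d => by simp [lsum, Finset.smul_sum]

theorem EqMod.eulerB {N : ℕ} {f g : MvPowerSeries Var V} (h : EqMod N f g) :
    EqMod N (eulerB f) (eulerB g) := fun d hd => by simp [h d hd]

theorem EqMod.eulerB_zero {N : ℕ} {f : MvPowerSeries Var V} (h : EqMod N f 0) :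
    EqMod N (GradedUniformization.eulerB f) 0 := fun d hd => by simp [h d hd]

end Additive

variable {A : Type*} [Ring A]

theorem eulerB_mul (f g : MvPowerSeries Var A) : eulerB (f * g) = eulerB f * g + f * eulerB g := by
  funext d
  simp only [eulerB_apply, series_mul_apply, series_add_apply, Finset.smul_sum]
  rw [← Finset.sum_add_distrib]
  refine Finset.sum_congr rfl fun ab hab => ?_
  rw [← mem_antidiagonal.1 hab, orderB_add, add_smul, smul_mul_assoc, mul_smul_comm]

theorem eulerB_one : eulerB (1 : MvPowerSeries Var A) = 0 := by
  have := eulerB_mul (1 : MvPowerSeries Var A) 1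
  simpa using this

end Euler

/-! ### Powers of an element, commutators and derivations -/

section Commutators

variable {A : Type*} [Ring A]

/-- Left multiplication by f is the sum of ad f and right multiplication by f, and these commute;
this is the binomial theorem for them, with x n = (ad f)^n (x 0). -/
theorem sub_pow_mul (f : A) (x : ℕ → A) (hx : ∀ n, x (n + 1) = f * x n - x n * f) (k : ℕ) :
    f ^ k * x 0 = ∑ n ∈ Finset.range (k + 1), k.choose n • (x n * f ^ (k - n)) := by
  induction k with
  | zero => simp
  | succ k ih =>
    have hf : ∀ n, f * x n = x (n + 1) + x n * f := fun n => by rw [hx]; abel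
    have e1 : f ^ (k + 1) * x 0 = ∑ n ∈ Finset.range (k + 1), k.choose n • (x (n + 1) * f ^ (k - n))
        + ∑ n ∈ Finset.range (k + 1), k.choose n • (x n * f ^ (k + 1 - n)) := by
      rw [pow_succ', mul_assoc, ih, Finset.mul_sum, ← Finset.sum_add_distrib]
      refine Finset.sum_congr rfl fun n hn => ?_
      rw [Finset.mem_range] at hn
      rw [mul_smul_comm, ← mul_assoc, hf, add_mul, smul_add, mul_assoc (x n), ← pow_succ',
        show k - n + 1 = k + 1 - n by omega]
    have e2 : ∑ n ∈ Finset.range (k + 1), k.choose n • (x n * f ^ (k + 1 - n)) =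
        ∑ n ∈ Finset.range (k + 1), k.choose (n + 1) • (x (n + 1) * f ^ (k - n))
          + x 0 * f ^ (k + 1) := by
      have := Finset.sum_range_succ' (fun n => k.choose n • (x n * f ^ (k + 1 - n))) (k + 1)
      rw [Finset.sum_range_succ, Nat.choose_succ_self, zero_smul, add_zero] at this
      simpa using this
    rw [e1, e2, ← add_assoc, ← Finset.sum_add_distrib, Finset.sum_range_succ' _ (k + 1)]
    simp only [Nat.choose_succ_succ, add_smul, Nat.add_sub_add_right, Nat.choose_zero_right,
      one_smul, Nat.sub_zero]

/-- Moving every commutator of f with D f to the left of the powers of f; the coefficients satisfy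
Pascal's rule under D(f · f^k) = D f · f^k + f · D(f^k). -/
theorem derivation_pow_succ (D : A → A) (hD : ∀ a b, D (a * b) = D a * b + a * D b) (f : A)
    (x : ℕ → A) (h0 : x 0 = D f) (hx : ∀ n, x (n + 1) = f * x n - x n * f) (k : ℕ) :
    D (f ^ (k + 1)) =
      ∑ n ∈ Finset.range (k + 1), (k + 1).choose (n + 1) • (x n * f ^ (k - n)) := by
  induction k with
  | zero => simp [h0]
  | succ k ih =>
    have hf : ∀ n, f * x n = x (n + 1) + x n * f := fun n => by rw [hx]; abel
    have e1 : f * D (f ^ (k + 1)) =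
        ∑ n ∈ Finset.range (k + 1), (k + 1).choose (n + 1) • (x (n + 1) * f ^ (k - n))
        + ∑ n ∈ Finset.range (k + 1), (k + 1).choose (n + 1) • (x n * f ^ (k + 1 - n)) := by
      rw [ih, Finset.mul_sum, ← Finset.sum_add_distrib]
      refine Finset.sum_congr rfl fun n hn => ?_
      rw [Finset.mem_range] at hn
      rw [mul_smul_comm, ← mul_assoc, hf, add_mul, smul_add, mul_assoc (x n), ← pow_succ',
        show k - n + 1 = k + 1 - n by omega]
    have e2 : ∑ n ∈ Finset.range (k + 2), (k + 1).choose n • (x n * f ^ (k + 1 - n)) =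
        ∑ n ∈ Finset.range (k + 1), (k + 1).choose (n + 1) • (x (n + 1) * f ^ (k - n))
          + x 0 * f ^ (k + 1) := by
      rw [Finset.sum_range_succ']
      simp
    have e3 : ∑ n ∈ Finset.range (k + 2), (k + 1).choose (n + 1) • (x n * f ^ (k + 1 - n)) =
        ∑ n ∈ Finset.range (k + 1), (k + 1).choose (n + 1) • (x n * f ^ (k + 1 - n)) := by
      rw [Finset.sum_range_succ, Nat.choose_succ_self, zero_smul, add_zero]
    rw [pow_succ', hD, e1, ← h0, ← e3, ← add_assoc, add_comm (x 0 * _), ← e2,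
      ← Finset.sum_add_distrib]
    exact Finset.sum_congr rfl fun n _ => by rw [Nat.choose_succ_succ (k + 1) n, add_smul]

end Commutators

/-! ### Exponentials in the enveloping algebra -/

section Enveloping

variable (F : Type*) {𝔭 : Type*} [Field F] [LieRing 𝔭] [LieAlgebra F 𝔭]

/-- The coefficients of the exponential series. -/
noncomputable def expCoeff (n : ℕ) : F := (n.factorial : F)⁻¹

/-- The coefficients of the series `(e^x - 1) / x`. -/
noncomputable def dexpCoeff (n : ℕ) : F := ((n + 1).factorial : F)⁻¹

theorem expCoeff_zero : expCoeff F 0 = 1 := by simp [expCoeff]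

theorem dexpCoeff_zero : dexpCoeff F 0 = 1 := by simp [dexpCoeff]

variable {F}

theorem expCoeff_mul_choose [CharZero F] {n k : ℕ} (h : n ≤ k) :
    expCoeff F k * k.choose n = expCoeff F n * expCoeff F (k - n) := by
  unfold expCoeff
  rw [Nat.cast_choose F h]
  have h1 : (k.factorial : F) ≠ 0 := Nat.cast_ne_zero.2 k.factorial_ne_zero
  have h2 : (n.factorial : F) ≠ 0 := Nat.cast_ne_zero.2 n.factorial_ne_zero
  have h3 : ((k - n).factorial : F) ≠ 0 := Nat.cast_ne_zero.2 (k - n).factorial_ne_zero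
  field_simp

variable (F)

@[simp] theorem toU_apply (f : MvPowerSeries Var 𝔭) (d : Mon) :
    toU F f d = UniversalEnvelopingAlgebra.ι F (f d) := rfl

theorem toU_add (f g : MvPowerSeries Var 𝔭) : toU F (f + g) = toU F f + toU F g :=
  funext fun d => by simp

theorem toU_zero : toU F (0 : MvPowerSeries Var 𝔭) = 0 :=
  funext fun d => by simp

theorem toU_smul (c : F) (f : MvPowerSeries Var 𝔭) : toU F (c • f) = c • toU F f :=
  funext fun d => by simp

theorem toU_lsum (s : ℕ → MvPowerSeries Var 𝔭) : toU F (lsum s) = lsum fun n => toU F (s n) :=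
  funext fun d => by simp [lsum]

theorem toU_eulerB (f : MvPowerSeries Var 𝔭) : toU F (eulerB f) = eulerB (toU F f) :=
  funext fun d => by simp

variable {F} in
theorem EqMod.toU {N : ℕ} {f g : MvPowerSeries Var 𝔭} (h : EqMod N f g) :
    EqMod N (toU F f) (toU F g) := fun d hd => by simp [h d hd]

variable {F} in
theorem EqMod.toU_zero {N : ℕ} {f : MvPowerSeries Var 𝔭} (h : EqMod N f 0) :
    EqMod N (GradedUniformization.toU F f) 0 := fun d hd => by simp [h d hd]

theorem ι_lie (x y : 𝔭) : UniversalEnvelopingAlgebra.ι F ⁅x, y⁆ =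
    UniversalEnvelopingAlgebra.ι F x * UniversalEnvelopingAlgebra.ι F y -
      UniversalEnvelopingAlgebra.ι F y * UniversalEnvelopingAlgebra.ι F x := by
  let _ : LieRing (UniversalEnvelopingAlgebra F 𝔭) := LieRing.ofAssociativeRing
  exact LieHom.map_lie (UniversalEnvelopingAlgebra.ι F) x y

theorem toU_lie (f g : MvPowerSeries Var 𝔭) :
    toU F ⁅f, g⁆ = toU F f * toU F g - toU F g * toU F f := by
  funext d
  have e : (toU F g * toU F f) d = ∑ ab ∈ antidiagonal d, toU F g ab.2 * toU F f ab.1 := by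
    rw [series_mul_apply]
    exact Finsupp.sum_antidiagonal_swap d fun a b => toU F g a * toU F f b
  rw [series_sub_apply, e, toU_apply, series_lie_apply, series_mul_apply, map_sum,
    ← Finset.sum_sub_distrib]
  exact Finset.sum_congr rfl fun ab _ => ι_lie F _ _

theorem expU_eq_lsum {Ψ : MvPowerSeries Var 𝔭} (hΨ : EqMod 1 Ψ 0) :
    expU F Ψ = lsum fun k => expCoeff F k • toU F Ψ ^ k :=
  formalExp_eq_lsum hΨ.toU_zero

theorem expCoeff_terms_eqMod {Ψ : MvPowerSeries Var 𝔭} (hΨ : EqMod 1 Ψ 0) (k : ℕ) :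
    EqMod k (expCoeff F k • toU F Ψ ^ k) 0 :=
  exp_terms_eqMod hΨ.toU_zero k

theorem smul_sum_range_choose [CharZero F] {A : Type*} [Ring A] [Algebra F A] (x : ℕ → A) (f : A)
    (k : ℕ) : expCoeff F k • ∑ n ∈ Finset.range (k + 1), k.choose n • (x n * f ^ (k - n)) =
      ∑ ij ∈ antidiagonal k, (expCoeff F ij.1 • x ij.1) * (expCoeff F ij.2 • f ^ ij.2) := by
  rw [Finset.Nat.sum_antidiagonal_eq_sum_range_succ
    (fun i j => (expCoeff F i • x i) * (expCoeff F j • f ^ j)), Finset.smul_sum]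
  refine Finset.sum_congr rfl fun n hn => ?_
  rw [smul_mul_smul_comm, ← expCoeff_mul_choose (by simpa [Nat.lt_succ_iff] using hn), mul_smul,
    Nat.cast_smul_eq_nsmul]

theorem smul_sum_range_choose_succ [CharZero F] {A : Type*} [Ring A] [Algebra F A] (x : ℕ → A)
    (f : A) (k : ℕ) :
    expCoeff F (k + 1) •
        ∑ n ∈ Finset.range (k + 1), (k + 1).choose (n + 1) • (x n * f ^ (k - n)) =
      ∑ ij ∈ antidiagonal k, (dexpCoeff F ij.1 • x ij.1) * (expCoeff F ij.2 • f ^ ij.2) := by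
  rw [Finset.Nat.sum_antidiagonal_eq_sum_range_succ
    (fun i j => (dexpCoeff F i • x i) * (expCoeff F j • f ^ j)), Finset.smul_sum]
  refine Finset.sum_congr rfl fun n hn => ?_
  have := expCoeff_mul_choose (F := F) (n := n + 1) (k := k + 1)
    (by simpa [Nat.lt_succ_iff] using hn)
  rw [Nat.add_sub_add_right] at this
  rw [smul_mul_smul_comm, dexpCoeff, ← expCoeff, ← this, mul_smul, Nat.cast_smul_eq_nsmul]

variable [CharZero F]

/-- Conjugation by an exponential is the exponential of the adjoint action. -/
theorem expU_mul_toU {Ψ : MvPowerSeries Var 𝔭} (hΨ : EqMod 1 Ψ 0) (h : MvPowerSeries Var 𝔭) :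
    expU F Ψ * toU F h = toU F (adSeries (expCoeff F) Ψ h) * expU F Ψ := by
  rw [expU_eq_lsum F hΨ, adSeries, toU_lsum,
    lsum_mul_lsum (fun n => (adSeries_terms_eqMod (expCoeff F) hΨ n).toU_zero)
      (expCoeff_terms_eqMod F hΨ), lsum_mul (expCoeff_terms_eqMod F hΨ)]
  refine lsum_congr fun k => ?_
  simp only [toU_smul]
  rw [← smul_sum_range_choose F (fun n => toU F (adPow Ψ h n)), smul_mul_assoc]
  congr 1
  exact sub_pow_mul (toU F Ψ) (fun n => toU F (adPow Ψ h n)) (fun n => toU_lie F _ _) k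

/-- The logarithmic derivative of an exponential. -/
theorem eulerB_expU {Ψ : MvPowerSeries Var 𝔭} (hΨ : EqMod 1 Ψ 0) :
    eulerB (expU F Ψ) = toU F (adSeries (dexpCoeff F) Ψ (eulerB Ψ)) * expU F Ψ := by
  -- The derivation kills the term k = 0; the resulting shift of index produces the coefficients
  -- 1/(n+1)!.
  rw [expU_eq_lsum F hΨ, adSeries, toU_lsum,
    lsum_mul_lsum (fun n => (adSeries_terms_eqMod (dexpCoeff F) hΨ n).toU_zero)
      (expCoeff_terms_eqMod F hΨ), eulerB_lsum,
    lsum_shift (fun n => (expCoeff_terms_eqMod F hΨ n).eulerB_zero)]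
  · refine lsum_congr fun k => ?_
    simp only [toU_smul]
    rw [← smul_sum_range_choose_succ F (fun n => toU F (adPow Ψ (eulerB Ψ) n)), eulerB_smul]
    congr 1
    exact derivation_pow_succ eulerB eulerB_mul (toU F Ψ)
      (fun n => toU F (adPow Ψ (eulerB Ψ) n)) (toU_eulerB F Ψ) (fun n => toU_lie F _ _) k
  · rw [pow_zero, eulerB_smul, eulerB_one, smul_zero]

end Enveloping

/-! ### The linear equation E X = a X -/

section LinearEquation

/-- Two series agree in order zero in the `ℬ_j`'s. -/
def EqOrderBZero {V : Type*} (f g : MvPowerSeries Var V) : Prop := ∀ d, orderB d = 0 → f d = g d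

theorem EqOrderBZero.mul {A : Type*} [Ring A] {f f' g g' : MvPowerSeries Var A} (h : EqOrderBZero f f')
    (h' : EqOrderBZero g g') : EqOrderBZero (f * g) (f' * g') := by
  intro d hd
  rw [series_mul_apply, series_mul_apply]
  refine Finset.sum_congr rfl fun ab hab => ?_
  have := congrArg orderB (mem_antidiagonal.1 hab)
  rw [orderB_add] at this
  rw [h _ (by omega), h' _ (by omega)]

theorem EqOrderBZero.pow {A : Type*} [Ring A] {f f' : MvPowerSeries Var A} (h : EqOrderBZero f f') (k : ℕ) :
    EqOrderBZero (f ^ k) (f' ^ k) := by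
  induction k with
  | zero => exact fun d _ => by rw [pow_zero, pow_zero]
  | succ k ih => rw [pow_succ, pow_succ]; exact ih.mul h

theorem EqOrderBZero.expU {F 𝔭 : Type*} [Field F] [LieRing 𝔭] [LieAlgebra F 𝔭] {Ψ Φ : MvPowerSeries Var 𝔭}
    (hΨ : EqMod 1 Ψ 0) (hΦ : EqMod 1 Φ 0) (h : EqOrderBZero Ψ Φ) :
    EqOrderBZero (expU F Ψ) (expU F Φ) := by
  intro d hd
  rw [expU_eq_lsum F hΨ, expU_eq_lsum F hΦ]
  refine Finset.sum_congr rfl fun k _ => ?_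
  have h' : EqOrderBZero (toU F Ψ) (toU F Φ) := fun d hd => by simp [h d hd]
  change expCoeff F k • (toU F Ψ ^ k) d = expCoeff F k • (toU F Φ ^ k) d
  rw [h'.pow k d hd]

/-- Since a has no constant term, the coefficient of a X at d involves X only in lower degrees. When
the ℬ-order of d is positive it is invertible in F, so X d is determined; ℬ-order zero is the
initial condition. -/
theorem eq_of_eulerB_eq_mul (F : Type*) {A : Type*} [Field F] [CharZero F] [Ring A] [Algebra F A]
    {a X Y : MvPowerSeries Var A} (ha : a 0 = 0)
    (hX : eulerB X = a * X) (hY : eulerB Y = a * Y) (h : EqOrderBZero X Y) : X = Y := by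
  refine eq_of_forall_eqMod fun N => ?_
  induction N with
  | zero => exact fun d hd => absurd hd (Nat.not_lt_zero _)
  | succ N ih =>
    intro d hd
    by_cases h0 : orderB d = 0
    · exact h d h0
    have e : (a * X) d = (a * Y) d := by
      rw [series_mul_apply, series_mul_apply]
      refine Finset.sum_congr rfl fun ab hab => ?_
      have := congrArg Finsupp.degree (mem_antidiagonal.1 hab)
      rw [map_add] at this
      by_cases h1 : ab.1.degree = 0
      · rw [(Finsupp.degree_eq_zero_iff _).1 h1, ha, zero_mul, zero_mul]
      · rw [ih _ (by omega)]
    rw [← hX, ← hY, eulerB_apply, eulerB_apply, ← Nat.cast_smul_eq_nsmul F,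
      ← Nat.cast_smul_eq_nsmul F] at e
    exact smul_right_injective _ (Nat.cast_ne_zero.2 h0) e

end LinearEquation

/-! ### The series g⁺, g⁻ and their bracket -/

section FormalSum

variable {L : Type*} [AddCommGroup L] {ι : Type*}

theorem exists_of_formalSum_ne_zero {d : ι → Mon} {x : ι → L} {n : Mon}
    (h : formalSum d x n ≠ 0) : ∃ i, d i = n := by
  by_contra! hc
  refine h (finsum_eq_zero_of_forall_eq_zero fun i => ?_)
  have : IsEmpty (d i = n) := ⟨hc i⟩
  exact finsum_of_isEmpty _

theorem formalSum_apply_of_injective {d : ι → Mon} (hd : Function.Injective d) (x : ι → L) (i : ι) :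
    formalSum d x (d i) = x i := by
  change ∑ᶠ (j : ι) (_ : d j = d i), x j = x i
  simp only [hd.eq_iff]
  exact finsum_mem_singleton (f := x) (a := i)

theorem monA_injective : Function.Injective monA := fun _ _ h =>
  Sum.inl_injective (Finsupp.single_left_injective one_ne_zero h)

theorem monB_injective : Function.Injective monB := fun _ _ h =>
  Sum.inr_injective (Finsupp.single_left_injective one_ne_zero h)

@[simp] theorem orderA_monA (j) : orderA (monA j) = 1 := by
  rw [orderA, monA, Finsupp.sum_single_index rfl]; rfl

@[simp] theorem orderB_monA (j) : orderB (monA j) = 0 := by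
  rw [orderB, monA, Finsupp.sum_single_index rfl]; rfl

@[simp] theorem orderA_monB (j) : orderA (monB j) = 0 := by
  rw [orderA, monB, Finsupp.sum_single_index rfl]; rfl

@[simp] theorem orderB_monB (j) : orderB (monB j) = 1 := by
  rw [orderB, monB, Finsupp.sum_single_index rfl]; rfl

theorem monA_add_monB_injective :
    Function.Injective fun x : {j : ℤ // 0 < j} × {j : ℤ // j < 0} => monA x.1 + monB x.2 := by
  rintro ⟨i, k⟩ ⟨j, l⟩ h
  have h1 : i = j := by
    have := DFunLike.congr_fun h (Sum.inl i)
    by_contra hc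
    simp [monA, monB, Ne.symm hc] at this
  have h2 : k = l := by
    have := DFunLike.congr_fun h (Sum.inr k)
    by_contra hc
    simp [monA, monB, Ne.symm hc] at this
  rw [h1, h2]

variable {𝔭 : Type*} [LieRing 𝔭]
  (p : {j : ℤ // 0 < j} → 𝔭) (q : {j : ℤ // j < 0} → 𝔭)

theorem gPlus_monA (j) : gPlus p (monA j) = p j := formalSum_apply_of_injective monA_injective p j

theorem gMinus_monB (j) : gMinus q (monB j) = q j := formalSum_apply_of_injective monB_injective q j

variable {p q}

theorem orders_of_gPlus_ne_zero {d : Mon} (h : gPlus p d ≠ 0) : orderA d = 1 ∧ orderB d = 0 := by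
  obtain ⟨j, rfl⟩ := exists_of_formalSum_ne_zero h
  simp

theorem orders_of_gMinus_ne_zero {d : Mon} (h : gMinus q d ≠ 0) : orderA d = 0 ∧ orderB d = 1 := by
  obtain ⟨j, rfl⟩ := exists_of_formalSum_ne_zero h
  simp

theorem orders_of_lie_ne_zero {d : Mon} (h : ⁅gPlus p, gMinus q⁆ d ≠ 0) :
    orderA d = 1 ∧ orderB d = 1 := by
  rw [series_lie_apply] at h
  obtain ⟨ab, hab, hne⟩ := Finset.exists_ne_zero_of_sum_ne_zero h
  have h1 := orders_of_gPlus_ne_zero (p := p) (d := ab.1) fun h => hne (by rw [h, zero_lie])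
  have h2 := orders_of_gMinus_ne_zero (q := q) (d := ab.2) fun h => hne (by rw [h, lie_zero])
  rw [← mem_antidiagonal.1 hab, orderA_add, orderB_add]
  omega

variable (p q)

theorem gPlus_eqMod : EqMod 1 (gPlus p) 0 := eqMod_one_iff.2 <| by
  by_contra h
  have := orders_of_gPlus_ne_zero h
  simp [orderA] at this

theorem gMinus_eqMod : EqMod 1 (gMinus q) 0 := eqMod_one_iff.2 <| by
  by_contra h
  have := orders_of_gMinus_ne_zero h
  simp [orderB] at this

theorem eulerB_gPlus : eulerB (gPlus p) = 0 := funext fun d => by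
  by_cases h : gPlus p d = 0
  · simp [h]
  · simp [(orders_of_gPlus_ne_zero h).2]

theorem eulerB_gMinus : eulerB (gMinus q) = gMinus q := funext fun d => by
  by_cases h : gMinus q d = 0
  · simp [h]
  · simp [(orders_of_gMinus_ne_zero h).2]

theorem lie_monA_add_monB (i : {j : ℤ // 0 < j}) (k : {j : ℤ // j < 0}) :
    ⁅gPlus p, gMinus q⁆ (monA i + monB k) = ⁅p i, q k⁆ := by
  rw [series_lie_apply, Finset.sum_eq_single (monA i, monB k)]
  · rw [gPlus_monA, gMinus_monB]
  · intro ab hab hne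
    by_contra hc
    have h1 : gPlus p ab.1 ≠ 0 := fun h => hc (by rw [h, zero_lie])
    have h2 : gMinus q ab.2 ≠ 0 := fun h => hc (by rw [h, lie_zero])
    obtain ⟨i', hi⟩ := exists_of_formalSum_ne_zero h1
    obtain ⟨k', hk⟩ := exists_of_formalSum_ne_zero h2
    have hab' := mem_antidiagonal.1 hab
    rw [← hi, ← hk] at hab'
    have := monA_add_monB_injective (a₁ := (i', k')) (a₂ := (i, k)) hab'
    rw [Prod.mk.injEq] at this
    exact hne (Prod.ext (by rw [← hi, this.1]) (by rw [← hk, this.2]))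
  · have : (monA i, monB k) ∈ antidiagonal (monA i + monB k) := by rw [mem_antidiagonal]
    exact fun h => absurd this h

end FormalSum

/-! ### Projections onto the graded parts -/

section Projections

variable {F 𝔭 : Type*} [Field F] [LieRing 𝔭] [LieAlgebra F 𝔭]
  (ℒ : ℤ → Submodule F 𝔭) [GradedLieAlgebra ℒ]

theorem gradedProj_of_mem {S : Set ℤ} {j : ℤ} (hj : j ∈ S) {x : 𝔭} (hx : x ∈ ℒ j) :
    gradedProj ℒ S x = x := by
  classical
  simp only [gradedProj, LinearMap.comp_apply, LinearEquiv.coe_coe,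
    DirectSum.decomposeLinearEquiv_apply]
  rw [DirectSum.decompose_of_mem ℒ hx]
  erw [DirectSum.toModule_lof]
  simp [hj]

theorem gradedProj_of_notMem {S : Set ℤ} {j : ℤ} (hj : j ∉ S) {x : 𝔭} (hx : x ∈ ℒ j) :
    gradedProj ℒ S x = 0 := by
  classical
  simp only [gradedProj, LinearMap.comp_apply, LinearEquiv.coe_coe,
    DirectSum.decomposeLinearEquiv_apply]
  rw [DirectSum.decompose_of_mem ℒ hx]
  erw [DirectSum.toModule_lof]
  simp [hj]

theorem gradedProj_mem (S : Set ℤ) (x : 𝔭) : gradedProj ℒ S x ∈ gradedPart ℒ S := by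
  induction x using DirectSum.Decomposition.inductionOn ℒ with
  | zero => rw [map_zero]; exact Submodule.zero_mem _
  | @homogeneous j x =>
    by_cases hj : j ∈ S
    · rw [gradedProj_of_mem ℒ hj x.2]
      exact Submodule.mem_iSup_of_mem j (Submodule.mem_iSup_of_mem hj x.2)
    · rw [gradedProj_of_notMem ℒ hj x.2]
      exact Submodule.zero_mem _
  | add x y hx hy => rw [map_add]; exact Submodule.add_mem _ hx hy

theorem gradedProj_of_mem_gradedPart {S : Set ℤ} {x : 𝔭} (hx : x ∈ gradedPart ℒ S) :
    gradedProj ℒ S x = x := by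
  have : gradedPart ℒ S ≤ LinearMap.eqLocus (gradedProj ℒ S) LinearMap.id :=
    iSup₂_le fun j hj y hy => gradedProj_of_mem ℒ hj hy
  exact this hx

theorem gradedProj_of_mem_gradedPart_of_disjoint {S T : Set ℤ} (hST : Disjoint S T) {x : 𝔭}
    (hx : x ∈ gradedPart ℒ T) : gradedProj ℒ S x = 0 := by
  have : gradedPart ℒ T ≤ LinearMap.ker (gradedProj ℒ S) :=
    iSup₂_le fun j hj y hy => gradedProj_of_notMem ℒ (hST.notMem_of_mem_right hj) hy
  exact this hx

theorem gradedProj_add_add (x : 𝔭) :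
    gradedProj ℒ (Set.Iio 0) x + gradedProj ℒ {0} x + gradedProj ℒ (Set.Ioi 0) x = x := by
  induction x using DirectSum.Decomposition.inductionOn ℒ with
  | zero => simp
  | @homogeneous j x =>
    rcases lt_trichotomy j 0 with h | h | h
    · rw [gradedProj_of_mem ℒ (Set.mem_Iio.2 h) x.2, gradedProj_of_notMem ℒ (by simp; omega) x.2,
        gradedProj_of_notMem ℒ (by simp; omega) x.2, add_zero, add_zero]
    · rw [gradedProj_of_notMem ℒ (by simp; omega) x.2, gradedProj_of_mem ℒ (by simp; omega) x.2,
        gradedProj_of_notMem ℒ (by simp; omega) x.2, zero_add, add_zero]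
    · rw [gradedProj_of_notMem ℒ (by simp; omega) x.2, gradedProj_of_notMem ℒ (by simp; omega) x.2,
        gradedProj_of_mem ℒ (Set.mem_Ioi.2 h) x.2, zero_add, zero_add]
  | add x y hx hy =>
    conv_rhs => rw [← hx, ← hy]
    simp only [map_add]
    abel

@[simp] theorem serProj_apply (S : Set ℤ) (f : MvPowerSeries Var 𝔭) (d : Mon) :
    serProj ℒ S f d = gradedProj ℒ S (f d) := rfl

theorem serProj_add (S : Set ℤ) (f g : MvPowerSeries Var 𝔭) :
    serProj ℒ S (f + g) = serProj ℒ S f + serProj ℒ S g := funext fun d => by simp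

theorem serProj_sub (S : Set ℤ) (f g : MvPowerSeries Var 𝔭) :
    serProj ℒ S (f - g) = serProj ℒ S f - serProj ℒ S g := funext fun d => by simp

theorem serProj_zero (S : Set ℤ) : serProj ℒ S (0 : MvPowerSeries Var 𝔭) = 0 :=
  funext fun d => by simp

theorem serProj_add_add (f : MvPowerSeries Var 𝔭) :
    serProj ℒ (Set.Iio 0) f + serProj ℒ {0} f + serProj ℒ (Set.Ioi 0) f = f :=
  funext fun d => gradedProj_add_add ℒ (f d)

theorem hasCoeffsIn_serProj (S : Set ℤ) (f : MvPowerSeries Var 𝔭) :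
    HasCoeffsIn ℒ S (serProj ℒ S f) := fun d => gradedProj_mem ℒ S (f d)

variable {ℒ}

theorem EqMod.serProj {N : ℕ} {f g : MvPowerSeries Var 𝔭} (h : EqMod N f g) (S : Set ℤ) :
    EqMod N (serProj ℒ S f) (serProj ℒ S g) := fun d hd => by simp [h d hd]

theorem EqMod.serProj_zero {N : ℕ} {f : MvPowerSeries Var 𝔭} (h : EqMod N f 0) (S : Set ℤ) :
    EqMod N (GradedUniformization.serProj ℒ S f) 0 := fun d hd => by simp [h d hd]

variable {p : {j : ℤ // 0 < j} → 𝔭} {q : {j : ℤ // j < 0} → 𝔭}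

theorem serProj_gPlus_of_subset (hp : ∀ j : {j : ℤ // 0 < j}, p j ∈ ℒ j.1) {S : Set ℤ}
    (hS : Set.Ioi 0 ⊆ S) : serProj ℒ S (gPlus p) = gPlus p := funext fun d => by
  rw [serProj_apply]
  by_cases h : gPlus p d = 0
  · rw [h, map_zero]
  · obtain ⟨j, rfl⟩ := exists_of_formalSum_ne_zero h
    rw [gPlus_monA]
    exact gradedProj_of_mem ℒ (hS j.2) (hp j)

theorem serProj_gPlus_of_disjoint (hp : ∀ j : {j : ℤ // 0 < j}, p j ∈ ℒ j.1) {S : Set ℤ}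
    (hS : Disjoint S (Set.Ioi 0)) : serProj ℒ S (gPlus p) = 0 := funext fun d => by
  rw [serProj_apply]
  by_cases h : gPlus p d = 0
  · rw [h, map_zero]; rfl
  · obtain ⟨j, rfl⟩ := exists_of_formalSum_ne_zero h
    rw [gPlus_monA]
    exact gradedProj_of_notMem ℒ (hS.notMem_of_mem_right j.2) (hp j)

theorem serProj_gMinus_of_subset (hq : ∀ j : {j : ℤ // j < 0}, q j ∈ ℒ j.1) {S : Set ℤ}
    (hS : Set.Iio 0 ⊆ S) : serProj ℒ S (gMinus q) = gMinus q := funext fun d => by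
  rw [serProj_apply]
  by_cases h : gMinus q d = 0
  · rw [h, map_zero]
  · obtain ⟨j, rfl⟩ := exists_of_formalSum_ne_zero h
    rw [gMinus_monB]
    exact gradedProj_of_mem ℒ (hS j.2) (hq j)

theorem serProj_gMinus_of_disjoint (hq : ∀ j : {j : ℤ // j < 0}, q j ∈ ℒ j.1) {S : Set ℤ}
    (hS : Disjoint S (Set.Iio 0)) : serProj ℒ S (gMinus q) = 0 := funext fun d => by
  rw [serProj_apply]
  by_cases h : gMinus q d = 0
  · rw [h, map_zero]; rfl
  · obtain ⟨j, rfl⟩ := exists_of_formalSum_ne_zero h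
    rw [gMinus_monB]
    exact gradedProj_of_notMem ℒ (hS.notMem_of_mem_right j.2) (hq j)

/-- Since [p i, q k] is homogeneous of degree i + k, the projection keeps it or kills it according
to whether i + k lies in S. -/
theorem serProj_lie_eq_orderTwo (hp : ∀ j : {j : ℤ // 0 < j}, p j ∈ ℒ j.1)
    (hq : ∀ j : {j : ℤ // j < 0}, q j ∈ ℒ j.1) (S : Set ℤ) :
    serProj ℒ S ⁅gPlus p, gMinus q⁆ = orderTwo p q S := funext fun d => by
  have hinj : Function.Injective
      fun x : {x : {j : ℤ // 0 < j} × {j : ℤ // j < 0} // (x.1 : ℤ) + (x.2 : ℤ) ∈ S} =>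
        monA x.1.1 + monB x.1.2 :=
    monA_add_monB_injective.comp Subtype.val_injective
  by_cases hd : ∃ i k, d = monA i + monB k
  · obtain ⟨i, k, rfl⟩ := hd
    have hmem : ⁅p i, q k⁆ ∈ ℒ (i.1 + k.1) := SetLike.GradedBracket.bracket_mem (hp i) (hq k)
    rw [serProj_apply, lie_monA_add_monB]
    by_cases hS : (i : ℤ) + k ∈ S
    · rw [gradedProj_of_mem ℒ hS hmem]
      exact (formalSum_apply_of_injective hinj (fun x => ⁅p x.1.1, q x.1.2⁆) ⟨(i, k), hS⟩).symm
    · rw [gradedProj_of_notMem ℒ hS hmem]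
      by_contra hc
      obtain ⟨⟨⟨i', k'⟩, h'⟩, e⟩ := exists_of_formalSum_ne_zero (Ne.symm hc)
      have := monA_add_monB_injective (a₁ := (i', k')) (a₂ := (i, k)) e
      rw [Prod.mk.injEq] at this
      rw [← this.1, ← this.2] at hS
      exact hS h'
  · have h1 : orderTwo p q S d = 0 := by
      by_contra hc
      obtain ⟨x, e⟩ := exists_of_formalSum_ne_zero hc
      exact hd ⟨_, _, e.symm⟩
    rw [h1, serProj_apply, series_lie_apply, Finset.sum_eq_zero, map_zero]
    intro ab hab
    by_contra hc
    have h1 : gPlus p ab.1 ≠ 0 := fun h => hc (by rw [h, zero_lie])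
    have h2 : gMinus q ab.2 ≠ 0 := fun h => hc (by rw [h, lie_zero])
    obtain ⟨i, hi⟩ := exists_of_formalSum_ne_zero h1
    obtain ⟨k, hk⟩ := exists_of_formalSum_ne_zero h2
    exact hd ⟨i, k, by rw [hi, hk, mem_antidiagonal.1 hab]⟩

end Projections

/-! ### Series of words -/

section Words

section BihomPart

variable {L : Type*} [AddCommGroup L] (m n : ℕ)

theorem bihomPart_apply (f : MvPowerSeries Var L) (d : Mon) :
    bihomPart m n f d = if orderB d = m ∧ orderA d = n then f d else 0 := rfl

theorem bihomPart_self (f : MvPowerSeries Var L) (d : Mon) :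
    bihomPart (orderB d) (orderA d) f d = f d := if_pos ⟨rfl, rfl⟩

theorem bihomPart_add (f g : MvPowerSeries Var L) :
    bihomPart m n (f + g) = bihomPart m n f + bihomPart m n g := funext fun d => by
  simp only [bihomPart_apply, series_add_apply]
  split_ifs <;> simp

theorem bihomPart_smul {F : Type*} [Semiring F] [Module F L] (c : F) (f : MvPowerSeries Var L) :
    bihomPart m n (c • f) = c • bihomPart m n f := funext fun d => by
  simp only [bihomPart_apply, series_smul_apply]
  split_ifs <;> simp

theorem bihomPart_congr {f g : MvPowerSeries Var L} (h : EqMod (m + n + 1) f g) :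
    bihomPart m n f = bihomPart m n g := funext fun d => by
  simp only [bihomPart_apply]
  split_ifs with hd
  · refine h d ?_
    rw [← orderA_add_orderB]
    omega
  · rfl

/-- On monomials of order (m, n) the total degree is m + n, which is where the sum is truncated. -/
theorem bihomPart_lsum (s : ℕ → MvPowerSeries Var L) :
    bihomPart m n (lsum s) = ∑ k ∈ Finset.range (m + n + 1), bihomPart m n (s k) :=
  funext fun d => by
    simp only [bihomPart_apply, series_sum_apply]
    split_ifs with hd
    · rw [lsum, ← orderA_add_orderB, hd.1, hd.2, add_comm n m]
    · simp

theorem bihomPart_lie {L : Type*} [LieRing L] (f g : MvPowerSeries Var L) :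
    bihomPart m n ⁅f, g⁆ = ∑ ms ∈ antidiagonal m, ∑ ns ∈ antidiagonal n,
      ⁅bihomPart ms.1 ns.1 f, bihomPart ms.2 ns.2 g⁆ := funext fun d => by
  simp only [series_sum_apply, series_lie_apply, bihomPart_apply]
  rw [← Finset.sum_product', Finset.sum_comm]
  split_ifs with hd
  · refine Finset.sum_congr rfl fun ab hab => ?_
    have hA := congrArg orderA (mem_antidiagonal.1 hab)
    have hB := congrArg orderB (mem_antidiagonal.1 hab)
    rw [orderA_add] at hA
    rw [orderB_add] at hB
    rw [Finset.sum_eq_single ((orderB ab.1, orderB ab.2), (orderA ab.1, orderA ab.2))]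
    · simp
    · rintro ⟨⟨m1, m2⟩, ⟨n1, n2⟩⟩ - hne
      split_ifs with h1 h2
      · obtain ⟨rfl, rfl⟩ := h1
        obtain ⟨rfl, rfl⟩ := h2
        exact absurd rfl hne
      all_goals simp
    · intro h
      refine absurd ?_ h
      simp
      omega
  · symm
    refine Finset.sum_eq_zero fun ab hab => Finset.sum_eq_zero ?_
    rintro ⟨⟨m1, m2⟩, ⟨n1, n2⟩⟩ h
    have hA := congrArg orderA (mem_antidiagonal.1 hab)
    have hB := congrArg orderB (mem_antidiagonal.1 hab)
    rw [orderA_add] at hA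
    rw [orderB_add] at hB
    have hm := mem_antidiagonal.1 (Finset.mem_product.1 h).1
    have hn := mem_antidiagonal.1 (Finset.mem_product.1 h).2
    dsimp only at hm hn ⊢
    split_ifs with h1 h2
    · exact absurd ⟨by omega, by omega⟩ hd
    all_goals simp

end BihomPart

variable {F 𝔭 : Type*} [Field F] [LieRing 𝔭] [LieAlgebra F 𝔭]
  {ℒ : ℤ → Submodule F 𝔭} [GradedLieAlgebra ℒ]

theorem bihomPart_serProj (m n : ℕ) (S : Set ℤ) (f : MvPowerSeries Var 𝔭) :
    bihomPart m n (serProj ℒ S f) = serProj ℒ S (bihomPart m n f) := funext fun d => by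
  simp only [bihomPart_apply, serProj_apply]
  split_ifs <;> simp

/-- The linear combinations of words with `m` letters `u` and `n` letters `v`. -/
def wordSpan (ℒ : ℤ → Submodule F 𝔭) [GradedLieAlgebra ℒ] (u v : MvPowerSeries Var 𝔭) (m n : ℕ) :
    Submodule F (MvPowerSeries Var 𝔭) :=
  Submodule.span F {w | IsWord ℒ u v m n w}

theorem lie_mem_wordSpan {u v : MvPowerSeries Var 𝔭} {m n m' n' : ℕ} {x y : MvPowerSeries Var 𝔭}
    (hx : x ∈ wordSpan ℒ u v m n) (hy : y ∈ wordSpan ℒ u v m' n') :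
    ⁅x, y⁆ ∈ wordSpan ℒ u v (m + m') (n + n') := by
  refine Submodule.span_induction (p := fun x _ => ⁅x, y⁆ ∈ wordSpan ℒ u v (m + m') (n + n'))
    (fun w hw => ?_) ?_ (fun a b _ _ ha hb => ?_) (fun c a _ ha => ?_) hx
  · refine Submodule.span_induction (p := fun y _ => ⁅w, y⁆ ∈ wordSpan ℒ u v (m + m') (n + n'))
      (fun w' hw' => ?_) ?_ (fun a b _ _ ha hb => ?_) (fun c a _ ha => ?_) hy
    · exact Submodule.subset_span (IsWord.bracket hw hw')
    · rw [lie_zero]; exact Submodule.zero_mem _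
    · rw [lie_add]; exact Submodule.add_mem _ ha hb
    · rw [lie_smul]; exact Submodule.smul_mem _ c ha
  · rw [zero_lie]; exact Submodule.zero_mem _
  · rw [add_lie]; exact Submodule.add_mem _ ha hb
  · rw [smul_lie]; exact Submodule.smul_mem _ c ha

theorem serProj_mem_wordSpan {u v : MvPowerSeries Var 𝔭} {m n : ℕ} {S : Set ℤ}
    (hS : ∀ w, IsWord ℒ u v m n w → IsWord ℒ u v m n (serProj ℒ S w)) {x : MvPowerSeries Var 𝔭}
    (hx : x ∈ wordSpan ℒ u v m n) : serProj ℒ S x ∈ wordSpan ℒ u v m n := by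
  refine Submodule.span_induction (p := fun x _ => serProj ℒ S x ∈ wordSpan ℒ u v m n)
    (fun w hw => Submodule.subset_span (hS w hw)) ?_ (fun a b _ _ ha hb => ?_)
    (fun c a _ ha => ?_) hx
  · rw [serProj_zero]; exact Submodule.zero_mem _
  · rw [serProj_add]; exact Submodule.add_mem _ ha hb
  · have : serProj ℒ S (c • a) = c • serProj ℒ S a := funext fun d => by simp
    rw [this]; exact Submodule.smul_mem _ c ha

variable {p : {j : ℤ // 0 < j} → 𝔭} {q : {j : ℤ // j < 0} → 𝔭} {f g : MvPowerSeries Var 𝔭}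

namespace IsWordSeries

theorem zero : IsWordSeries ℒ p q 0 := fun m n => by
  have : bihomPart m n (0 : MvPowerSeries Var 𝔭) = 0 := funext fun d => by simp [bihomPart_apply]
  rw [this]
  exact Submodule.zero_mem _

theorem add (hf : IsWordSeries ℒ p q f) (hg : IsWordSeries ℒ p q g) :
    IsWordSeries ℒ p q (f + g) := fun m n => by
  rw [bihomPart_add]; exact Submodule.add_mem _ (hf m n) (hg m n)

theorem smul (hf : IsWordSeries ℒ p q f) (c : F) : IsWordSeries ℒ p q (c • f) := fun m n => by
  rw [bihomPart_smul]; exact Submodule.smul_mem _ c (hf m n)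

theorem sub (hf : IsWordSeries ℒ p q f) (hg : IsWordSeries ℒ p q g) :
    IsWordSeries ℒ p q (f - g) := by
  have := hf.add (hg.smul (-1))
  rwa [neg_one_smul, ← sub_eq_add_neg] at this

theorem lsum {s : ℕ → MvPowerSeries Var 𝔭} (hs : ∀ k, IsWordSeries ℒ p q (s k)) :
    IsWordSeries ℒ p q (lsum s) := fun m n => by
  rw [bihomPart_lsum]; exact Submodule.sum_mem _ fun k _ => hs k m n

theorem lie (hf : IsWordSeries ℒ p q f) (hg : IsWordSeries ℒ p q g) :
    IsWordSeries ℒ p q ⁅f, g⁆ := fun m n => by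
  rw [bihomPart_lie]
  refine Submodule.sum_mem _ fun ms hms => Submodule.sum_mem _ fun ns hns => ?_
  have := lie_mem_wordSpan (hf ms.1 ns.1) (hg ms.2 ns.2)
  rwa [mem_antidiagonal.1 hms, mem_antidiagonal.1 hns] at this

theorem serProj_Iio (hf : IsWordSeries ℒ p q f) : IsWordSeries ℒ p q (serProj ℒ (Set.Iio 0) f) :=
  fun m n => by
    rw [bihomPart_serProj]
    exact serProj_mem_wordSpan (fun _ => IsWord.projNeg) (hf m n)

theorem serProj_zero (hf : IsWordSeries ℒ p q f) : IsWordSeries ℒ p q (serProj ℒ {0} f) :=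
  fun m n => by
    rw [bihomPart_serProj]
    exact serProj_mem_wordSpan (fun _ => IsWord.projZero) (hf m n)

theorem serProj_Ioi (hf : IsWordSeries ℒ p q f) : IsWordSeries ℒ p q (serProj ℒ (Set.Ioi 0) f) :=
  fun m n => by
    rw [bihomPart_serProj]
    exact serProj_mem_wordSpan (fun _ => IsWord.projPos) (hf m n)

/-- The weight is constant on each bihomogeneous part; this covers both the Euler derivation and its
inverse. -/
theorem of_weight (hf : IsWordSeries ℒ p q f) (c : ℕ → F) :
    IsWordSeries ℒ p q (fun d => c (orderB d) • f d : MvPowerSeries Var 𝔭) := fun m n => by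
  have : bihomPart m n (fun d => c (orderB d) • f d : MvPowerSeries Var 𝔭)
      = c m • bihomPart m n f := funext fun d => by
    change (if orderB d = m ∧ orderA d = n then c (orderB d) • f d else 0)
      = c m • (if orderB d = m ∧ orderA d = n then f d else 0)
    split_ifs with h
    · rw [h.1]
    · rw [smul_zero]
  rw [this]
  exact Submodule.smul_mem _ _ (hf m n)

theorem eulerB (hf : IsWordSeries ℒ p q f) : IsWordSeries ℒ p q (eulerB f) := by
  have : GradedUniformization.eulerB f
      = (fun d => (orderB d : F) • f d : MvPowerSeries Var 𝔭) :=
    funext fun d => (Nat.cast_smul_eq_nsmul F _ _).symm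
  rw [this]
  exact hf.of_weight fun k => (k : F)

theorem adSeries (hf : IsWordSeries ℒ p q f) (hg : IsWordSeries ℒ p q g) (c : ℕ → F) :
    IsWordSeries ℒ p q (adSeries c f g) := by
  refine IsWordSeries.lsum fun n => IsWordSeries.smul ?_ _
  induction n with
  | zero => exact hg
  | succ n ih => exact hf.lie ih

theorem of_single {w : MvPowerSeries Var 𝔭} {m n : ℕ} (hw : IsWord ℒ (gMinus q) (gPlus p) m n w)
    (h : ∀ d, w d ≠ 0 → orderB d = m ∧ orderA d = n) : IsWordSeries ℒ p q w := fun m' n' => by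
  by_cases hmn : m' = m ∧ n' = n
  · obtain ⟨rfl, rfl⟩ := hmn
    have : bihomPart m' n' w = w := funext fun d => by
      rw [bihomPart_apply]
      split_ifs with hd
      · rfl
      · by_contra hc
        exact hd (h d (Ne.symm hc))
    rw [this]
    exact Submodule.subset_span hw
  · have : bihomPart m' n' w = 0 := funext fun d => by
      rw [bihomPart_apply]
      split_ifs with hd
      · by_contra hc
        obtain ⟨h1, h2⟩ := h d hc
        exact hmn ⟨hd.1.symm.trans h1, hd.2.symm.trans h2⟩
      · rfl
    rw [this]
    exact Submodule.zero_mem _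

theorem gMinus : IsWordSeries ℒ p q (gMinus q) :=
  of_single IsWord.left fun _ h => (orders_of_gMinus_ne_zero h).symm

theorem gPlus : IsWordSeries ℒ p q (gPlus p) :=
  of_single IsWord.right fun _ h => (orders_of_gPlus_ne_zero h).symm

/-- Being a series of words is a closed condition: the part of order (m, n) is seen modulo degree m
+ n + 1. -/
theorem of_eqMod {s : ℕ → MvPowerSeries Var 𝔭} (hs : ∀ k, IsWordSeries ℒ p q (s k))
    (h : ∀ N, EqMod N f (s N)) : IsWordSeries ℒ p q f := fun m n => by
  rw [bihomPart_congr m n (h (m + n + 1))]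
  exact hs _ m n

end IsWordSeries

/-- The bracket [g⁻, g⁻] vanishes and each projection fixes or kills g⁻, so words in g⁻ alone never
get beyond the letter. -/
theorem IsWord.eq_of_right_eq_zero (hq : ∀ j : {j : ℤ // j < 0}, q j ∈ ℒ j.1) {m n : ℕ}
    {w : MvPowerSeries Var 𝔭} (hw : IsWord ℒ (gMinus q) (gPlus p) m n w) (hn : n = 0) :
    w = 0 ∨ m = 1 ∧ w = gMinus q := by
  induction hw with
  | left => exact Or.inr ⟨rfl, rfl⟩
  | right => exact absurd hn one_ne_zero
  | bracket _ _ ih ih' =>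
    left
    rcases ih (by omega) with rfl | ⟨-, rfl⟩
    · rw [zero_lie]
    rcases ih' (by omega) with rfl | ⟨-, rfl⟩
    · rw [lie_zero]
    · rw [lie_self]
  | projNeg _ ih =>
    rcases ih hn with rfl | ⟨rfl, rfl⟩
    · exact Or.inl (serProj_zero ℒ _)
    · exact Or.inr ⟨rfl, serProj_gMinus_of_subset hq subset_rfl⟩
  | projZero _ ih =>
    rcases ih hn with rfl | ⟨rfl, rfl⟩
    · exact Or.inl (serProj_zero ℒ _)
    · exact Or.inl (serProj_gMinus_of_disjoint hq (by simp))
  | projPos _ ih =>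
    rcases ih hn with rfl | ⟨rfl, rfl⟩
    · exact Or.inl (serProj_zero ℒ _)
    · exact Or.inl (serProj_gMinus_of_disjoint hq
        (Set.disjoint_left.2 fun x h h' => lt_asymm (Set.mem_Ioi.1 h) (Set.mem_Iio.1 h')))

theorem IsWord.eq_of_left_eq_zero (hp : ∀ j : {j : ℤ // 0 < j}, p j ∈ ℒ j.1) {m n : ℕ}
    {w : MvPowerSeries Var 𝔭} (hw : IsWord ℒ (gMinus q) (gPlus p) m n w) (hm : m = 0) :
    w = 0 ∨ n = 1 ∧ w = gPlus p := by
  induction hw with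
  | right => exact Or.inr ⟨rfl, rfl⟩
  | left => exact absurd hm one_ne_zero
  | bracket _ _ ih ih' =>
    left
    rcases ih (by omega) with rfl | ⟨-, rfl⟩
    · rw [zero_lie]
    rcases ih' (by omega) with rfl | ⟨-, rfl⟩
    · rw [lie_zero]
    · rw [lie_self]
  | projPos _ ih =>
    rcases ih hm with rfl | ⟨rfl, rfl⟩
    · exact Or.inl (serProj_zero ℒ _)
    · exact Or.inr ⟨rfl, serProj_gPlus_of_subset hp subset_rfl⟩
  | projZero _ ih =>
    rcases ih hm with rfl | ⟨rfl, rfl⟩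
    · exact Or.inl (serProj_zero ℒ _)
    · exact Or.inl (serProj_gPlus_of_disjoint hp (by simp))
  | projNeg _ ih =>
    rcases ih hm with rfl | ⟨rfl, rfl⟩
    · exact Or.inl (serProj_zero ℒ _)
    · exact Or.inl (serProj_gPlus_of_disjoint hp
        (Set.disjoint_left.2 fun x h h' => lt_asymm (Set.mem_Ioi.1 h') (Set.mem_Iio.1 h)))

theorem IsWordSeries.apply_eq_zero (hf : IsWordSeries ℒ p q f) {d : Mon}
    (h : ∀ w, IsWord ℒ (GradedUniformization.gMinus q) (GradedUniformization.gPlus p)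
      (orderB d) (orderA d) w → w = 0) : f d = 0 := by
  have h1 := hf (orderB d) (orderA d)
  have h2 : bihomPart (orderB d) (orderA d) f = 0 := by
    rw [← Submodule.mem_bot F]
    refine Submodule.span_le.2 ?_ h1
    exact fun w hw => h w hw
  rw [← bihomPart_self f d, h2, series_zero_apply]

/-- Terms of degree below two cancel by `h2`. In degree at least two, a monomial in one kind of
variable would need a nonzero word of length at least two in a single letter, and there is none. -/
theorem IsWordSeries.onlyMixedTerms (hp : ∀ j : {j : ℤ // 0 < j}, p j ∈ ℒ j.1)
    (hq : ∀ j : {j : ℤ // j < 0}, q j ∈ ℒ j.1) (hf : IsWordSeries ℒ p q f)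
    (h2 : EqMod 2 f (GradedUniformization.gPlus p + GradedUniformization.gMinus q)) :
    OnlyMixedTerms (f - (GradedUniformization.gPlus p + GradedUniformization.gMinus q)) := by
  intro d hd
  have hdeg : 2 ≤ d.degree := by
    by_contra hc
    exact hd (by rw [series_sub_apply, h2 d (by omega), sub_self])
  rw [← orderA_add_orderB] at hdeg
  by_contra hc
  have hP : GradedUniformization.gPlus p d = 0 := by
    by_contra h
    have := orders_of_gPlus_ne_zero h
    omega
  have hM : GradedUniformization.gMinus q d = 0 := by
    by_contra h
    have := orders_of_gMinus_ne_zero h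
    omega
  refine hd ?_
  rw [series_sub_apply, series_add_apply, hP, hM, add_zero, sub_zero]
  refine hf.apply_eq_zero fun w hw => ?_
  by_cases hA : orderA d = 0
  · rcases hw.eq_of_right_eq_zero hq hA with h | h
    · exact h
    · omega
  · rcases hw.eq_of_left_eq_zero hp (by omega) with h | h
    · exact h
    · omega

end Words

/-! ### Fixed points of contractions in the degree-adic sense -/

section FixedPoint

variable {σ V : Type*} [AddCommGroup V]

/-- Degree by degree the iterates from 0 become stationary. The last clause is kept so that closed
properties of the iterates pass to the limit. -/
theorem exists_fixedPoint_of_contraction (T : MvPowerSeries σ V → MvPowerSeries σ V)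
    (h0 : ∀ f, EqMod 1 f 0 → EqMod 1 (T f) 0)
    (hT : ∀ N f g, EqMod 1 f 0 → EqMod 1 g 0 → EqMod N f g → EqMod (N + 1) (T f) (T g)) :
    ∃ f, EqMod 1 f 0 ∧ T f = f ∧ ∀ N, EqMod N f (T^[N] 0) := by
  have hz : ∀ N, EqMod 1 (T^[N] 0) 0 := fun N => by
    induction N with
    | zero => exact EqMod.refl _ _
    | succ N ih => rw [Function.iterate_succ_apply']; exact h0 _ ih
  have hstep : ∀ N, EqMod N (T^[N] 0) (T^[N + 1] 0) := fun N => by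
    induction N with
    | zero => exact fun d hd => absurd hd (Nat.not_lt_zero _)
    | succ N ih =>
      rw [Function.iterate_succ_apply', Function.iterate_succ_apply' T (N + 1)]
      exact hT N _ _ (hz _) (hz _) ih
  have hadd : ∀ N k, EqMod N (T^[N] 0) (T^[N + k] 0) := fun N k => by
    induction k with
    | zero => exact EqMod.refl _ _
    | succ k ih => exact ih.trans ((hstep (N + k)).mono (by omega))
  -- The coefficient at d no longer changes from the iterate number d.degree + 1 on.
  let f : MvPowerSeries σ V := fun d => T^[d.degree + 1] 0 d
  have hf : ∀ N, EqMod N f (T^[N] 0) := fun N d hd => by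
    obtain ⟨k, rfl⟩ := Nat.exists_eq_add_of_le hd
    exact hadd (d.degree + 1) k d (Nat.lt_succ_self _)
  have hf0 : EqMod 1 f 0 := (hf 1).trans (hz 1)
  refine ⟨f, hf0, eq_of_forall_eqMod fun N => ?_, hf⟩
  refine EqMod.mono ?_ (Nat.le_succ N)
  refine (hT N _ _ hf0 (hz N) (hf N)).trans ?_
  rw [← Function.iterate_succ_apply' T]
  exact (hf (N + 1)).symm

end FixedPoint

/-! ### The logarithmic derivative of the triple product -/

section LogDerivative

variable (F : Type*) {𝔭 : Type*} [Field F] [LieRing 𝔭] [LieAlgebra F 𝔭]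

/-- The logarithmic derivative of `e^Ψ⁻ e^Ψ⁺ e^Ψ⁰` with respect to `eulerB`. -/
noncomputable def logDeriv (Ψm Ψ0 Ψp : MvPowerSeries Var 𝔭) : MvPowerSeries Var 𝔭 :=
  adSeries (dexpCoeff F) Ψm (eulerB Ψm) + adSeries (expCoeff F) Ψm
    (adSeries (dexpCoeff F) Ψp (eulerB Ψp) +
      adSeries (expCoeff F) Ψp (adSeries (dexpCoeff F) Ψ0 (eulerB Ψ0)))

/-- By the product rule, the logarithmic derivative of each factor is conjugated past the
exponentials to its left. -/
theorem eulerB_expU_mul_expU_mul_expU [CharZero F] {Ψm Ψ0 Ψp : MvPowerSeries Var 𝔭}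
    (hm : EqMod 1 Ψm 0) (h0 : EqMod 1 Ψ0 0) (hp : EqMod 1 Ψp 0) :
    eulerB (expU F Ψm * expU F Ψp * expU F Ψ0) =
      toU F (logDeriv F Ψm Ψ0 Ψp) * (expU F Ψm * expU F Ψp * expU F Ψ0) := by
  rw [eulerB_mul, eulerB_mul, eulerB_expU F hm, eulerB_expU F h0, eulerB_expU F hp, logDeriv,
    toU_add]
  generalize adSeries (dexpCoeff F) Ψm (eulerB Ψm) = m
  generalize adSeries (dexpCoeff F) Ψp (eulerB Ψp) = v
  generalize adSeries (dexpCoeff F) Ψ0 (eulerB Ψ0) = z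
  have e1 := expU_mul_toU F hm (v + adSeries (expCoeff F) Ψp z)
  have e2 := expU_mul_toU F hp z
  rw [toU_add] at e1
  calc _ = toU F m * expU F Ψm * expU F Ψp * expU F Ψ0 +
        expU F Ψm * toU F v * expU F Ψp * expU F Ψ0 +
        expU F Ψm * (expU F Ψp * toU F z) * expU F Ψ0 := by noncomm_ring
    _ = toU F m * expU F Ψm * expU F Ψp * expU F Ψ0 +
        expU F Ψm * (toU F v + toU F (adSeries (expCoeff F) Ψp z)) * expU F Ψp * expU F Ψ0 := by
      rw [e2]; noncomm_ring
    _ = _ := by rw [e1]; noncomm_ring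

variable {F} in
theorem EqMod.logDeriv_zero {Ψm Ψ0 Ψp : MvPowerSeries Var 𝔭}
    (hm : EqMod 1 Ψm 0) (h0 : EqMod 1 Ψ0 0) (hp : EqMod 1 Ψp 0) :
    EqMod 1 (logDeriv F Ψm Ψ0 Ψp) 0 := by
  have h1 := adSeries_eqMod_zero (dexpCoeff F) hm hm.eulerB_zero
  have h2 := adSeries_eqMod_zero (dexpCoeff F) hp hp.eulerB_zero
  have h3 := adSeries_eqMod_zero (expCoeff F) hp
    (adSeries_eqMod_zero (dexpCoeff F) h0 h0.eulerB_zero)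
  have h4 := adSeries_eqMod_zero (expCoeff F) hm (by simpa using h2.add h3)
  simpa [logDeriv] using h1.add h4

variable {F} in
-- The logarithmic derivative is the Euler derivative of the sum of the three series plus iterated
-- brackets, so the difference gains a degree.
theorem EqMod.logDeriv_sub {N : ℕ} {Ψm Ψ0 Ψp Φm Φ0 Φp : MvPowerSeries Var 𝔭}
    (hm : EqMod 1 Ψm 0) (h0 : EqMod 1 Ψ0 0) (hp : EqMod 1 Ψp 0)
    (hm' : EqMod 1 Φm 0) (h0' : EqMod 1 Φ0 0) (hp' : EqMod 1 Φp 0)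
    (em : EqMod N Ψm Φm) (e0 : EqMod N Ψ0 Φ0) (ep : EqMod N Ψp Φp) :
    EqMod (N + 1) (logDeriv F Ψm Ψ0 Ψp - (GradedUniformization.eulerB Ψm
        + GradedUniformization.eulerB Ψ0 + GradedUniformization.eulerB Ψp))
      (logDeriv F Φm Φ0 Φp - (GradedUniformization.eulerB Φm
        + GradedUniformization.eulerB Φ0 + GradedUniformization.eulerB Φp)) := by
  have c := dexpCoeff_zero F
  have c' := expCoeff_zero F
  have z1 := adSeries_eqMod_zero (dexpCoeff F) h0 h0.eulerB_zero
  have z1' := adSeries_eqMod_zero (dexpCoeff F) h0' h0'.eulerB_zero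
  have z2 := adSeries_eqMod_zero (dexpCoeff F) hp hp.eulerB_zero
  have z2' := adSeries_eqMod_zero (dexpCoeff F) hp' hp'.eulerB_zero
  have z3 := z2.add (adSeries_eqMod_zero (expCoeff F) hp z1)
  have z3' := z2'.add (adSeries_eqMod_zero (expCoeff F) hp' z1')
  rw [add_zero] at z3 z3'
  have a1 := adSeries_sub_eqMod c hm hm' hm.eulerB_zero hm'.eulerB_zero em em.eulerB
  have a2 := adSeries_sub_eqMod c hp hp' hp.eulerB_zero hp'.eulerB_zero ep ep.eulerB
  have a3 := adSeries_sub_eqMod c h0 h0' h0.eulerB_zero h0'.eulerB_zero e0 e0.eulerB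
  have b2 := adSeries_eqMod c hp hp' hp.eulerB_zero hp'.eulerB_zero ep ep.eulerB
  have b3 := adSeries_eqMod c h0 h0' h0.eulerB_zero h0'.eulerB_zero e0 e0.eulerB
  have a4 := adSeries_sub_eqMod c' hp hp' z1 z1' ep b3
  have b4 := adSeries_eqMod c' hp hp' z1 z1' ep b3
  have a5 := adSeries_sub_eqMod c' hm hm' z3 z3' em (b2.add b4)
  -- The difference telescopes into five pieces, one for each application of `adSeries` in
  -- `logDeriv`, each of the form `adSeries c Ψ h - h`.
  have := (((a1.add a2).add a3).add a4).add a5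
  unfold logDeriv
  convert this using 1 <;> abel

end LogDerivative

/-! ### Mixed terms and the prescribed form -/

section Mixed

theorem OnlyMixedTerms.apply_zero {V : Type*} [AddCommGroup V] {f : MvPowerSeries Var V}
    (h : OnlyMixedTerms f) : EqMod 1 f 0 := eqMod_one_iff.2 <| by
  by_contra hc
  have := (h 0 hc).1
  simp [orderA] at this

variable {F 𝔭 : Type*} [Field F] [LieRing 𝔭] [LieAlgebra F 𝔭]
  {ℒ : ℤ → Submodule F 𝔭} {p : {j : ℤ // 0 < j} → 𝔭} {q : {j : ℤ // j < 0} → 𝔭}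

theorem OnlyMixedTerms.serProj [GradedLieAlgebra ℒ] {f : MvPowerSeries Var 𝔭}
    (h : OnlyMixedTerms f) (S : Set ℤ) : OnlyMixedTerms (serProj ℒ S f) := fun d hd =>
  h d fun hc => hd (by rw [serProj_apply, hc, map_zero])

theorem OnlyHigherMixedTerms.serProj [GradedLieAlgebra ℒ] {f : MvPowerSeries Var 𝔭}
    (h : OnlyHigherMixedTerms f) (S : Set ℤ) : OnlyHigherMixedTerms (serProj ℒ S f) := fun d hd =>
  h d fun hc => hd (by rw [serProj_apply, hc, map_zero])

theorem HasPrescribedForm.eqMod {Ψm Ψ0 Ψp : MvPowerSeries Var 𝔭}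
    (h : HasPrescribedForm ℒ p q Ψm Ψ0 Ψp) :
    EqMod 1 Ψm 0 ∧ EqMod 1 Ψ0 0 ∧ EqMod 1 Ψp 0 := by
  obtain ⟨-, -, -, Qm, Q0, Qp, ⟨-, hm⟩, ⟨-, h0⟩, ⟨-, hp⟩, rfl, rfl, rfl⟩ := h
  refine ⟨?_, h0.apply_zero, ?_⟩
  · simpa using (gMinus_eqMod q).add hm.apply_zero
  · simpa using (gPlus_eqMod p).add hp.apply_zero

end Mixed

/-! ### Uniqueness of the factorization -/

section Uniqueness

variable (F : Type*) {𝔭 : Type*} [Field F] [LieRing 𝔭] [LieAlgebra F 𝔭]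

theorem expU_zero : expU F (0 : MvPowerSeries Var 𝔭) = 1 := by
  rw [expU_eq_lsum F (EqMod.refl _ _), toU_zero]
  funext d
  simp only [lsum, Finset.sum_range_succ', series_smul_apply]
  simp [expCoeff]

variable {F}

theorem EqMod.pow {A : Type*} [Ring A] {N : ℕ} {f g : MvPowerSeries Var A} (h : EqMod N f g)
    (k : ℕ) : EqMod N (f ^ k) (g ^ k) := by
  induction k with
  | zero => rw [_root_.pow_zero, _root_.pow_zero]; exact EqMod.refl _ _
  | succ k ih => rw [pow_succ, pow_succ]; exact ih.mul h

/-- Only powers with exponent at least two remain, and products of series without constant term gain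
a degree. -/
theorem expU_sub_eqMod {N : ℕ} {Ψ Φ : MvPowerSeries Var 𝔭} (hΨ : EqMod 1 Ψ 0) (hΦ : EqMod 1 Φ 0)
    (h : EqMod N Ψ Φ) :
    EqMod (N + 1) (expU F Ψ - 1 - toU F Ψ) (expU F Φ - 1 - toU F Φ) := by
  have key : ∀ {Ψ : MvPowerSeries Var 𝔭}, EqMod 1 Ψ 0 → expU F Ψ - 1 - toU F Ψ =
      lsum fun k => if k < 2 then 0 else expCoeff F k • toU F Ψ ^ k := by
    intro Ψ hΨ
    rw [expU_eq_lsum F hΨ]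
    funext d
    have hk : ∀ k, EqMod k
        (if k < 2 then (0 : MvPowerSeries Var (UniversalEnvelopingAlgebra F 𝔭))
          else expCoeff F k • toU F Ψ ^ k) 0 := by
      intro k
      split_ifs
      · exact EqMod.refl _ _
      · exact expCoeff_terms_eqMod F hΨ k
    rw [series_sub_apply, series_sub_apply,
      lsum_apply (expCoeff_terms_eqMod F hΨ) (K := d.degree + 1 + 1) (by omega),
      lsum_apply hk (K := d.degree + 1 + 1) (by omega)]
    simp [Finset.sum_range_succ', expCoeff]
  rw [key hΨ, key hΦ]
  refine lsum_eqMod fun k => ?_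
  split_ifs with hk
  · exact EqMod.refl _ _
  · obtain ⟨k, rfl⟩ := Nat.exists_eq_add_of_le (not_lt.1 hk)
    refine EqMod.smul _ ?_
    rw [show 2 + k = k + 1 + 1 by omega, pow_succ, pow_succ _ (k + 1)]
    exact EqMod.mul_succ ((hΨ.toU_zero.pow_zero (k + 1)).mono (by omega))
      ((hΦ.toU_zero.pow_zero (k + 1)).mono (by omega)) hΨ.toU_zero hΦ.toU_zero (h.toU.pow _) h.toU

theorem expU_sub_one_eqMod_zero {Ψ : MvPowerSeries Var 𝔭} (hΨ : EqMod 1 Ψ 0) :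
    EqMod 1 (expU F Ψ - 1) 0 := by
  have h := expU_sub_eqMod (F := F) (N := 0) hΨ (EqMod.refl _ 0)
    (fun d hd => absurd hd (Nat.not_lt_zero _))
  rw [expU_zero, toU_zero, sub_self, sub_self] at h
  have := h.add (EqMod.toU_zero (F := F) hΨ)
  simpa using this

theorem expU_sub_one_eqMod {N : ℕ} {Ψ Φ : MvPowerSeries Var 𝔭} (hΨ : EqMod 1 Ψ 0)
    (hΦ : EqMod 1 Φ 0) (h : EqMod N Ψ Φ) : EqMod N (expU F Ψ - 1) (expU F Φ - 1) := by
  have := ((expU_sub_eqMod (F := F) hΨ hΦ h).mono (Nat.le_succ N)).add h.toU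
  simpa using this

/-- The product of exponentials is 1 plus the sum of the exponents plus products of at least two
factors without constant term. Agreement below degree N fixes the latter below degree N + 1, hence
also the sum. -/
theorem toU_add_add_eqMod_of_expU_mul_eq {N : ℕ} {Ψm Ψ0 Ψp Φm Φ0 Φp : MvPowerSeries Var 𝔭}
    (hm : EqMod 1 Ψm 0) (h0 : EqMod 1 Ψ0 0) (hp : EqMod 1 Ψp 0)
    (hm' : EqMod 1 Φm 0) (h0' : EqMod 1 Φ0 0) (hp' : EqMod 1 Φp 0)
    (em : EqMod N Ψm Φm) (e0 : EqMod N Ψ0 Φ0) (ep : EqMod N Ψp Φp)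
    (h : expU F Ψm * expU F Ψp * expU F Ψ0 = expU F Φm * expU F Φp * expU F Φ0) :
    EqMod (N + 1) (toU F (Ψm + Ψ0 + Ψp))
      (toU F (Φm + Φ0 + Φp)) := by
  have b1 := expU_sub_one_eqMod (F := F) hm hm' em
  have b2 := expU_sub_one_eqMod (F := F) hp hp' ep
  have b3 := expU_sub_one_eqMod (F := F) h0 h0' e0
  have z1 := expU_sub_one_eqMod_zero (F := F) hm
  have z2 := expU_sub_one_eqMod_zero (F := F) hp
  have z3 := expU_sub_one_eqMod_zero (F := F) h0
  have z1' := expU_sub_one_eqMod_zero (F := F) hm'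
  have z2' := expU_sub_one_eqMod_zero (F := F) hp'
  have z3' := expU_sub_one_eqMod_zero (F := F) h0'
  have c1 := EqMod.mul_succ z1 z1' z2 z2' b1 b2
  have w1 := (z1.add z2).add ((z1.mul_zero z2).mono (Nat.le_add_left 1 1))
  have w1' := (z1'.add z2').add ((z1'.mul_zero z2').mono (Nat.le_add_left 1 1))
  rw [add_zero, add_zero] at w1 w1'
  have c2 := EqMod.mul_succ w1 w1' z3 z3' ((b1.add b2).add (b1.mul b2)) b3
  have a1 := expU_sub_eqMod (F := F) hm hm' em
  have a2 := expU_sub_eqMod (F := F) hp hp' ep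
  have a3 := expU_sub_eqMod (F := F) h0 h0' e0
  -- Expansion of (1 + x)(1 + y)(1 + z), solved for the linear terms of the three exponentials.
  have key : ∀ a b c : MvPowerSeries Var 𝔭, toU F (a + b + c) =
      expU F a * expU F c * expU F b - 1
      - ((expU F a - 1 - toU F a) + (expU F c - 1 - toU F c) + (expU F b - 1 - toU F b))
      - (expU F a - 1) * (expU F c - 1)
      - (expU F a - 1 + (expU F c - 1) + (expU F a - 1) * (expU F c - 1)) * (expU F b - 1) := by
    intro a b c
    rw [toU_add, toU_add]
    noncomm_ring
  rw [key, key, h]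
  exact (((EqMod.refl _ _).sub ((a1.add a2).add a3)).sub c1).sub c2

variable {ℒ : ℤ → Submodule F 𝔭} [GradedLieAlgebra ℒ]

theorem disjoint_Iio_Ioi : Disjoint (Set.Iio (0 : ℤ)) (Set.Ioi 0) :=
  Set.disjoint_left.2 fun _ h h' => lt_asymm (Set.mem_Ioi.1 h') (Set.mem_Iio.1 h)

theorem eq_of_add_add_eq {a b c a' b' c' : 𝔭}
    (ha : a ∈ gradedPart ℒ (Set.Iio 0)) (hb : b ∈ gradedPart ℒ {0})
    (hc : c ∈ gradedPart ℒ (Set.Ioi 0)) (ha' : a' ∈ gradedPart ℒ (Set.Iio 0))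
    (hb' : b' ∈ gradedPart ℒ {0}) (hc' : c' ∈ gradedPart ℒ (Set.Ioi 0))
    (h : a + b + c = a' + b' + c') : a = a' ∧ b = b' ∧ c = c' := by
  have d1 : Disjoint (Set.Iio (0 : ℤ)) {0} := by simp
  have d2 : Disjoint (Set.Ioi (0 : ℤ)) {0} := by simp
  have d3 := disjoint_Iio_Ioi
  refine ⟨?_, ?_, ?_⟩
  · have := congrArg (gradedProj ℒ (Set.Iio 0)) h
    simpa only [map_add, gradedProj_of_mem_gradedPart ℒ ha, gradedProj_of_mem_gradedPart ℒ ha',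
      gradedProj_of_mem_gradedPart_of_disjoint ℒ d1 hb,
      gradedProj_of_mem_gradedPart_of_disjoint ℒ d1 hb',
      gradedProj_of_mem_gradedPart_of_disjoint ℒ d3 hc,
      gradedProj_of_mem_gradedPart_of_disjoint ℒ d3 hc', add_zero] using this
  · have := congrArg (gradedProj ℒ {0}) h
    simpa only [map_add, gradedProj_of_mem_gradedPart ℒ hb, gradedProj_of_mem_gradedPart ℒ hb',
      gradedProj_of_mem_gradedPart_of_disjoint ℒ d1.symm ha,
      gradedProj_of_mem_gradedPart_of_disjoint ℒ d1.symm ha',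
      gradedProj_of_mem_gradedPart_of_disjoint ℒ d2.symm hc,
      gradedProj_of_mem_gradedPart_of_disjoint ℒ d2.symm hc', add_zero, zero_add] using this
  · have := congrArg (gradedProj ℒ (Set.Ioi 0)) h
    simpa only [map_add, gradedProj_of_mem_gradedPart ℒ hc, gradedProj_of_mem_gradedPart ℒ hc',
      gradedProj_of_mem_gradedPart_of_disjoint ℒ d3.symm ha,
      gradedProj_of_mem_gradedPart_of_disjoint ℒ d3.symm ha',
      gradedProj_of_mem_gradedPart_of_disjoint ℒ d2 hb,
      gradedProj_of_mem_gradedPart_of_disjoint ℒ d2 hb', add_zero, zero_add] using this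

/-- The factors of a product `e^Ψ⁻ e^Ψ⁺ e^Ψ⁰` are unique. -/
theorem eq_of_expU_mul_expU_mul_expU_eq {Ψm Ψ0 Ψp Φm Φ0 Φp : MvPowerSeries Var 𝔭}
    (hm : EqMod 1 Ψm 0) (h0 : EqMod 1 Ψ0 0) (hp : EqMod 1 Ψp 0)
    (hm' : EqMod 1 Φm 0) (h0' : EqMod 1 Φ0 0) (hp' : EqMod 1 Φp 0)
    (cm : HasCoeffsIn ℒ (Set.Iio 0) Ψm) (c0 : HasCoeffsIn ℒ {0} Ψ0)
    (cp : HasCoeffsIn ℒ (Set.Ioi 0) Ψp) (cm' : HasCoeffsIn ℒ (Set.Iio 0) Φm)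
    (c0' : HasCoeffsIn ℒ {0} Φ0) (cp' : HasCoeffsIn ℒ (Set.Ioi 0) Φp)
    (h : expU F Ψm * expU F Ψp * expU F Ψ0 = expU F Φm * expU F Φp * expU F Φ0) :
    Ψm = Φm ∧ Ψ0 = Φ0 ∧ Ψp = Φp := by
  have key : ∀ N, EqMod N Ψm Φm ∧ EqMod N Ψ0 Φ0 ∧ EqMod N Ψp Φp := by
    intro N
    induction N with
    | zero => exact ⟨fun d hd => absurd hd (Nat.not_lt_zero _),
        fun d hd => absurd hd (Nat.not_lt_zero _), fun d hd => absurd hd (Nat.not_lt_zero _)⟩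
    | succ N ih =>
      have e := toU_add_add_eqMod_of_expU_mul_eq hm h0 hp hm' h0' hp' ih.1 ih.2.1 ih.2.2 h
      -- Injectivity of ι brings the equality back to 𝔭, where the graded parts are independent.
      have e' : ∀ d : Mon, d.degree < N + 1 → Ψm d = Φm d ∧ Ψ0 d = Φ0 d ∧ Ψp d = Φp d :=
        fun d hd => eq_of_add_add_eq (cm d) (c0 d) (cp d) (cm' d) (c0' d) (cp' d)
          (UniversalEnvelopingAlgebra.ι_injective F 𝔭 (e d hd))
      exact ⟨fun d hd => (e' d hd).1, fun d hd => (e' d hd).2.1, fun d hd => (e' d hd).2.2⟩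
  exact ⟨eq_of_forall_eqMod fun N => (key N).1, eq_of_forall_eqMod fun N => (key N).2.1,
    eq_of_forall_eqMod fun N => (key N).2.2⟩

end Uniqueness

/-! ### Parts of order zero in the ℬ-variables -/

section OrderBZero

variable {F 𝔭 : Type*} [Field F] [LieRing 𝔭] [LieAlgebra F 𝔭]

theorem EqOrderBZero.lie_right {f g : MvPowerSeries Var 𝔭} (h : EqOrderBZero g 0) :
    EqOrderBZero ⁅f, g⁆ 0 := by
  intro d hd
  rw [series_lie_apply]
  refine Finset.sum_eq_zero fun ab hab => ?_
  have := congrArg orderB (mem_antidiagonal.1 hab)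
  rw [orderB_add] at this
  rw [h _ (by omega), series_zero_apply, lie_zero]

theorem EqOrderBZero.adSeries (c : ℕ → F) {f g : MvPowerSeries Var 𝔭} (h : EqOrderBZero g 0) :
    EqOrderBZero (adSeries c f g) 0 := by
  have h' : ∀ n, EqOrderBZero (adPow f g n) 0 := fun n => by
    induction n with
    | zero => exact h
    | succ n ih => exact ih.lie_right
  intro d hd
  change ∑ n ∈ Finset.range (d.degree + 1), (c n • adPow f g n) d = 0
  exact Finset.sum_eq_zero fun n _ => by
    rw [series_smul_apply, h' n d hd, series_zero_apply, smul_zero]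

theorem EqOrderBZero.add {f g : MvPowerSeries Var 𝔭} (hf : EqOrderBZero f 0)
    (hg : EqOrderBZero g 0) : EqOrderBZero (f + g) 0 := fun d hd => by simp [hf d hd, hg d hd]

theorem eulerB_eqOrderBZero (f : MvPowerSeries Var 𝔭) : EqOrderBZero (eulerB f) 0 :=
  fun d hd => by simp [hd]

variable (F) in
theorem logDeriv_eqOrderBZero (Ψm Ψ0 Ψp : MvPowerSeries Var 𝔭) :
    EqOrderBZero (logDeriv F Ψm Ψ0 Ψp) 0 :=
  ((eulerB_eqOrderBZero _).adSeries _).add <| EqOrderBZero.adSeries _ <|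
    ((eulerB_eqOrderBZero _).adSeries _).add <| EqOrderBZero.adSeries _ <|
      (eulerB_eqOrderBZero _).adSeries _

theorem EqOrderBZero.serProj {ℒ : ℤ → Submodule F 𝔭} [GradedLieAlgebra ℒ]
    {f g : MvPowerSeries Var 𝔭} (h : EqOrderBZero f g) (S : Set ℤ) :
    EqOrderBZero (serProj ℒ S f) (serProj ℒ S g) := fun d hd => by simp [h d hd]

end OrderBZero

/-! ### The fixed-point equation and the factorization -/

section Factorization

variable (F : Type*) {𝔭 : Type*} [Field F] [LieRing 𝔭] [LieAlgebra F 𝔭]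

/-- The inverse of `eulerB` on series of positive order in the `ℬ_j`'s. -/
noncomputable def invEulerB (f : MvPowerSeries Var 𝔭) : MvPowerSeries Var 𝔭 :=
  fun d => (orderB d : F)⁻¹ • f d

@[simp] theorem invEulerB_apply (f : MvPowerSeries Var 𝔭) (d : Mon) :
    invEulerB F f d = (orderB d : F)⁻¹ • f d := rfl

/-- In ℬ-order zero the weight is the inverse of 0, which is 0 by convention; thus `invEulerB` never
alters the initial condition. -/
theorem invEulerB_eqOrderBZero (f : MvPowerSeries Var 𝔭) : EqOrderBZero (invEulerB F f) 0 :=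
  fun d hd => by simp [hd]

theorem invEulerB_eulerB [CharZero F] {f : MvPowerSeries Var 𝔭} (hf : EqOrderBZero f 0) :
    invEulerB F (eulerB f) = f := funext fun d => by
  by_cases h : orderB d = 0
  · simp [h, hf d h]
  · rw [invEulerB_apply, eulerB_apply, ← Nat.cast_smul_eq_nsmul F,
      inv_smul_smul₀ (Nat.cast_ne_zero.2 h)]

theorem eulerB_invEulerB [CharZero F] {f : MvPowerSeries Var 𝔭} (hf : EqOrderBZero f 0) :
    eulerB (invEulerB F f) = f := funext fun d => by
  by_cases h : orderB d = 0
  · simp [h, hf d h]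
  · rw [eulerB_apply, invEulerB_apply, ← Nat.cast_smul_eq_nsmul F,
      smul_inv_smul₀ (Nat.cast_ne_zero.2 h)]

variable {F} in
theorem EqMod.invEulerB {N : ℕ} {f g : MvPowerSeries Var 𝔭} (h : EqMod N f g) :
    EqMod N (invEulerB F f) (invEulerB F g) := fun d hd => by simp [h d hd]

theorem invEulerB_zero : invEulerB F (0 : MvPowerSeries Var 𝔭) = 0 := funext fun d => by simp

variable (p : {j : ℤ // 0 < j} → 𝔭) (q : {j : ℤ // j < 0} → 𝔭)

/-- The logarithmic derivative of `e^{g⁺} e^{g⁻}` with respect to `eulerB`. -/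
noncomputable def conjMinus : MvPowerSeries Var 𝔭 := adSeries (expCoeff F) (gPlus p) (gMinus q)

theorem conjMinus_eqMod_zero : EqMod 1 (conjMinus F p q) 0 :=
  adSeries_eqMod_zero _ (gPlus_eqMod p) (gMinus_eqMod q)

theorem lie_eqMod_two : EqMod 2 ⁅gPlus p, gMinus q⁆ 0 := (gPlus_eqMod p).lie_zero (gMinus_eqMod q)

theorem conjMinus_eqMod : EqMod 3 (conjMinus F p q) (gMinus q + ⁅gPlus p, gMinus q⁆) := by
  intro d hd
  rw [conjMinus, adSeries, lsum_apply (adSeries_terms_eqMod _ (gPlus_eqMod p)) hd]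
  have h : EqMod 3 ⁅gPlus p, ⁅gPlus p, gMinus q⁆⁆ 0 :=
    (gPlus_eqMod p).lie_zero (lie_eqMod_two p q)
  simp [Finset.sum_range_succ, adPow, expCoeff, h d hd]

theorem gMinus_eqOrderBZero : EqOrderBZero (gMinus q) 0 := fun d hd => by
  by_contra h
  have := orders_of_gMinus_ne_zero h
  omega

theorem conjMinus_eqOrderBZero : EqOrderBZero (conjMinus F p q) 0 :=
  (gMinus_eqOrderBZero q).adSeries _

/-- The first factor is constant for E, and the second has logarithmic derivative g⁻, which is
conjugated by e^{g⁺}. -/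
theorem eulerB_expU_mul_expU [CharZero F] :
    eulerB (expU F (gPlus p) * expU F (gMinus q)) =
      toU F (conjMinus F p q) * (expU F (gPlus p) * expU F (gMinus q)) := by
  rw [eulerB_mul, eulerB_expU F (gPlus_eqMod p), eulerB_expU F (gMinus_eqMod q), eulerB_gPlus,
    eulerB_gMinus, adSeries_zero, adSeries_self (dexpCoeff_zero F), toU_zero, zero_mul, zero_mul,
    zero_add, ← mul_assoc, expU_mul_toU F (gPlus_eqMod p), mul_assoc]
  rfl

variable (ℒ : ℤ → Submodule F 𝔭) [GradedLieAlgebra ℒ]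

/-- The logarithmic derivative of the product of the exponentials of the three projections. -/
noncomputable def projLogDeriv (Ψ : MvPowerSeries Var 𝔭) : MvPowerSeries Var 𝔭 :=
  logDeriv F (serProj ℒ (Set.Iio 0) Ψ) (serProj ℒ {0} Ψ) (serProj ℒ (Set.Ioi 0) Ψ)

/-- The map whose fixed point is the logarithm of `e^{g⁺} e^{g⁻}` in the coordinates
`e^Ψ⁻ e^Ψ⁺ e^Ψ⁰`. -/
noncomputable def picard (Ψ : MvPowerSeries Var 𝔭) : MvPowerSeries Var 𝔭 :=
  gPlus p + invEulerB F (conjMinus F p q - (projLogDeriv F ℒ Ψ - eulerB Ψ))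

theorem eulerB_serProj (Ψ : MvPowerSeries Var 𝔭) : eulerB (serProj ℒ (Set.Iio 0) Ψ) +
    eulerB (serProj ℒ {0} Ψ) + eulerB (serProj ℒ (Set.Ioi 0) Ψ) = eulerB Ψ := by
  rw [← eulerB_add, ← eulerB_add, serProj_add_add]

theorem picard_eqMod_zero (Ψ : MvPowerSeries Var 𝔭) (h : EqMod 1 Ψ 0) :
    EqMod 1 (picard F p q ℒ Ψ) 0 := by
  have h1 : EqMod 1 (projLogDeriv F ℒ Ψ) 0 :=
    EqMod.logDeriv_zero (h.serProj_zero _) (h.serProj_zero _) (h.serProj_zero _)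
  have h2 := (gPlus_eqMod p).add
    (((conjMinus_eqMod_zero F p q).sub (h1.sub h.eulerB_zero)).invEulerB (F := F))
  simpa [invEulerB_zero, picard] using h2

/-- The linear part E Ψ has been subtracted from the logarithmic derivative, so Ψ enters only
through brackets. -/
theorem picard_eqMod_succ (N : ℕ) (Ψ Φ : MvPowerSeries Var 𝔭) (hΨ : EqMod 1 Ψ 0)
    (hΦ : EqMod 1 Φ 0) (h : EqMod N Ψ Φ) :
    EqMod (N + 1) (picard F p q ℒ Ψ) (picard F p q ℒ Φ) := by
  have h1 := EqMod.logDeriv_sub (F := F) (hΨ.serProj_zero (ℒ := ℒ) (Set.Iio 0))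
    (hΨ.serProj_zero (ℒ := ℒ) {0}) (hΨ.serProj_zero (ℒ := ℒ) (Set.Ioi 0)) (hΦ.serProj_zero _)
    (hΦ.serProj_zero _) (hΦ.serProj_zero _) (h.serProj _) (h.serProj _) (h.serProj _)
  rw [eulerB_serProj, eulerB_serProj] at h1
  exact (EqMod.refl _ _).add ((EqMod.refl _ _).sub h1).invEulerB

variable {F p q ℒ}

theorem IsWordSeries.picard {Ψ : MvPowerSeries Var 𝔭} (h : IsWordSeries ℒ p q Ψ) :
    IsWordSeries ℒ p q (picard F p q ℒ Ψ) := by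
  have hm := h.serProj_Iio
  have h0 := h.serProj_zero
  have hp := h.serProj_Ioi
  have hD : IsWordSeries ℒ p q (projLogDeriv F ℒ Ψ) :=
    (hm.adSeries hm.eulerB _).add <| hm.adSeries
      ((hp.adSeries hp.eulerB _).add (hp.adSeries (h0.adSeries h0.eulerB _) _)) _
  exact IsWordSeries.gPlus.add
    (((IsWordSeries.gPlus.adSeries IsWordSeries.gMinus _).sub (hD.sub h.eulerB)).of_weight
      fun k => (k : F)⁻¹)

/-- Apply E to the fixed-point equation: g⁺ disappears, and E Ψ cancels. Inverting E loses nothing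
because the series it is applied to vanishes in ℬ-order zero. -/
theorem projLogDeriv_eq_of_picard_eq [CharZero F] {Ψ : MvPowerSeries Var 𝔭}
    (h : picard F p q ℒ Ψ = Ψ) : projLogDeriv F ℒ Ψ = conjMinus F p q := by
  have e : EqOrderBZero (conjMinus F p q - (projLogDeriv F ℒ Ψ - eulerB Ψ)) 0 := fun d hd => by
    rw [series_sub_apply, series_sub_apply, conjMinus_eqOrderBZero F p q d hd,
      eulerB_eqOrderBZero Ψ d hd, projLogDeriv, logDeriv_eqOrderBZero F _ _ _ d hd]
    simp
  have h2 := congrArg eulerB h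
  rw [picard, eulerB_add, eulerB_gPlus, zero_add, eulerB_invEulerB F e] at h2
  rw [sub_sub_eq_add_sub] at h2
  have h3 := sub_eq_iff_eq_add.1 h2
  rw [add_comm (eulerB Ψ)] at h3
  exact (add_right_cancel h3).symm

theorem eqOrderBZero_of_picard_eq {Ψ : MvPowerSeries Var 𝔭} (h : picard F p q ℒ Ψ = Ψ) :
    EqOrderBZero Ψ (gPlus p) := fun d hd => by
  conv_lhs => rw [← h]
  rw [picard, series_add_apply, invEulerB_eqOrderBZero F _ d hd, series_zero_apply, add_zero]

theorem disjoint_zero_Ioi : Disjoint ({0} : Set ℤ) (Set.Ioi 0) := by simp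

theorem disjoint_zero_Iio : Disjoint ({0} : Set ℤ) (Set.Iio 0) := by simp

/-- Both products solve E X = a X with a = e^{ad g⁺} g⁻, and in ℬ-order zero both reduce to e^{g⁺}.
-/
theorem expU_mul_eq_of_picard_eq [CharZero F] (hp : ∀ j : {j : ℤ // 0 < j}, p j ∈ ℒ j.1)
    {Ψ : MvPowerSeries Var 𝔭} (h0 : EqMod 1 Ψ 0) (h : picard F p q ℒ Ψ = Ψ) :
    expU F (gPlus p) * expU F (gMinus q) =
      expU F (serProj ℒ (Set.Iio 0) Ψ) * expU F (serProj ℒ (Set.Ioi 0) Ψ) *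
        expU F (serProj ℒ {0} Ψ) := by
  have z := EqMod.refl 1 (0 : MvPowerSeries Var 𝔭)
  have hm := h0.serProj_zero (ℒ := ℒ) (Set.Iio 0)
  have h0' := h0.serProj_zero (ℒ := ℒ) {0}
  have hp' := h0.serProj_zero (ℒ := ℒ) (Set.Ioi 0)
  have hB := eqOrderBZero_of_picard_eq h
  refine eq_of_eulerB_eq_mul F (a := toU F (conjMinus F p q)) ?_ (eulerB_expU_mul_expU F p q) ?_ ?_
  · exact eqMod_one_iff.1 (conjMinus_eqMod_zero F p q).toU_zero
  · rw [← projLogDeriv_eq_of_picard_eq h]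
    exact eulerB_expU_mul_expU_mul_expU F hm h0' hp'
  · have e1 : EqOrderBZero (serProj ℒ (Set.Iio 0) Ψ) 0 := by
      rw [← serProj_gPlus_of_disjoint hp disjoint_Iio_Ioi]; exact hB.serProj _
    have e2 : EqOrderBZero (serProj ℒ {0} Ψ) 0 := by
      rw [← serProj_gPlus_of_disjoint hp disjoint_zero_Ioi]; exact hB.serProj _
    have e3 : EqOrderBZero (serProj ℒ (Set.Ioi 0) Ψ) (gPlus p) := by
      rw [← serProj_gPlus_of_subset hp subset_rfl]; exact hB.serProj _
    have f1 := e1.expU (F := F) hm z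
    have f2 := e2.expU (F := F) h0' z
    have f3 := e3.expU (F := F) hp' (gPlus_eqMod p)
    have f4 := (gMinus_eqOrderBZero q).expU (F := F) (gMinus_eqMod q) z
    rw [expU_zero] at f1 f2 f4
    intro d hd
    have g1 := EqOrderBZero.mul (fun d _ => rfl : EqOrderBZero (expU F (gPlus p)) _) f4 d hd
    have g2 := (f1.mul f3).mul f2 d hd
    rw [g1, g2, one_mul]

/-- For Ψ⁻ = g⁻, Ψ⁰ = 0, Ψ⁺ = g⁺ the logarithmic derivative is g⁻, which equals E Ψ, so the
correction in `picard` vanishes. -/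
theorem picard_gPlus_add_gMinus (hp : ∀ j : {j : ℤ // 0 < j}, p j ∈ ℒ j.1)
    (hq : ∀ j : {j : ℤ // j < 0}, q j ∈ ℒ j.1) :
    picard F p q ℒ (gPlus p + gMinus q) = gPlus p + invEulerB F (conjMinus F p q) := by
  have h : projLogDeriv F ℒ (gPlus p + gMinus q) = gMinus q := by
    simp only [projLogDeriv, serProj_add, serProj_gPlus_of_disjoint hp disjoint_Iio_Ioi,
      serProj_gPlus_of_disjoint hp disjoint_zero_Ioi, serProj_gPlus_of_subset hp subset_rfl,
      serProj_gMinus_of_subset hq subset_rfl, serProj_gMinus_of_disjoint hq disjoint_zero_Iio,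
      serProj_gMinus_of_disjoint hq disjoint_Iio_Ioi.symm, zero_add, add_zero, logDeriv,
      eulerB_zero, eulerB_gPlus, eulerB_gMinus, adSeries_self (dexpCoeff_zero F), adSeries_zero]
  rw [picard, h, eulerB_add, eulerB_gPlus, eulerB_gMinus, zero_add, sub_self, sub_zero]

theorem picard_zero : picard F p q ℒ 0 = gPlus p + invEulerB F (conjMinus F p q) := by
  rw [picard, projLogDeriv, eulerB_zero]
  simp only [serProj_zero, logDeriv, eulerB_zero, adSeries_zero, add_zero, sub_zero]

/-- Comparing Ψ with 0 settles degrees below two; comparing it with g⁺ + g⁻ then settles degree two.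
At both points `picard` takes the value g⁺ + E⁻¹(e^{ad g⁺} g⁻), and E⁻¹ is the identity on g⁻ + [g⁺,
g⁻], which has ℬ-order one. -/
theorem eqMod_three_of_picard_eq [CharZero F] (hp : ∀ j : {j : ℤ // 0 < j}, p j ∈ ℒ j.1)
    (hq : ∀ j : {j : ℤ // j < 0}, q j ∈ ℒ j.1) {Ψ : MvPowerSeries Var 𝔭} (h0 : EqMod 1 Ψ 0)
    (h : picard F p q ℒ Ψ = Ψ) : EqMod 3 Ψ (gPlus p + gMinus q + ⁅gPlus p, gMinus q⁆) := by
  have hz : EqMod 1 (gPlus p + gMinus q) 0 := by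
    simpa using (gPlus_eqMod p).add (gMinus_eqMod q)
  have e : eulerB (gMinus q + ⁅gPlus p, gMinus q⁆) = gMinus q + ⁅gPlus p, gMinus q⁆ := by
    rw [eulerB_add, eulerB_gMinus]
    congr 1
    funext d
    by_cases hd : ⁅gPlus p, gMinus q⁆ d = 0
    · simp [hd]
    · simp [(orders_of_lie_ne_zero hd).2]
  have e' : EqOrderBZero (gMinus q + ⁅gPlus p, gMinus q⁆) 0 := by
    rw [← e]; exact eulerB_eqOrderBZero _
  have h3 : EqMod 3 (gPlus p + invEulerB F (conjMinus F p q))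
      (gPlus p + gMinus q + ⁅gPlus p, gMinus q⁆) := by
    have := (EqMod.refl 3 (gPlus p)).add ((conjMinus_eqMod F p q).invEulerB (F := F))
    rwa [← e, invEulerB_eulerB F e', ← add_assoc] at this
  have h2 : EqMod 2 Ψ (gPlus p + gMinus q) := by
    have a := picard_eqMod_succ F p q ℒ 1 Ψ 0 h0 (EqMod.refl _ _) h0
    rw [h, picard_zero] at a
    have b := (EqMod.refl 2 (gPlus p + gMinus q)).add (lie_eqMod_two p q)
    rw [add_zero] at b
    exact (a.trans (h3.mono (by omega))).trans b
  have a := picard_eqMod_succ F p q ℒ 2 Ψ _ h0 hz h2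
  rw [h, picard_gPlus_add_gMinus hp hq] at a
  exact a.trans h3

end Factorization

end GradedUniformization

/-! ### The theorem -/

open GradedUniformization

theorem corollary4p1 {F : Type*} [Field F] [CharZero F]
    {𝔭 : Type*} [LieRing 𝔭] [LieAlgebra F 𝔭]
    (ℒ : ℤ → Submodule F 𝔭) [GradedLieAlgebra ℒ]
    (p : {j : ℤ // 0 < j} → 𝔭) (hp : ∀ j : {j : ℤ // 0 < j}, p j ∈ ℒ j.1)
    (q : {j : ℤ // j < 0} → 𝔭) (hq : ∀ j : {j : ℤ // j < 0}, q j ∈ ℒ j.1) :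
    -- all the exponentials below are well defined
    (ExpDefined (toU F (gPlus p)) ∧ ExpDefined (toU F (gMinus q)) ∧
      ∀ Ψm Ψ0 Ψp : MvPowerSeries Var 𝔭, HasPrescribedForm ℒ p q Ψm Ψ0 Ψp →
        ExpDefined (toU F Ψm) ∧ ExpDefined (toU F Ψp) ∧ ExpDefined (toU F Ψ0)) ∧
    ∃ Ψm Ψ0 Ψp : MvPowerSeries Var 𝔭,
      -- existence
      (HasPrescribedForm ℒ p q Ψm Ψ0 Ψp ∧
        expU F (gPlus p) * expU F (gMinus q) = expU F Ψm * expU F Ψp * expU F Ψ0) ∧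
      -- uniqueness
      (∀ Φm Φ0 Φp : MvPowerSeries Var 𝔭, HasPrescribedForm ℒ p q Φm Φ0 Φp →
        expU F (gPlus p) * expU F (gMinus q) = expU F Φm * expU F Φp * expU F Φ0 →
        Φm = Ψm ∧ Φ0 = Ψ0 ∧ Φp = Ψp) ∧
      -- the three series are series of words
      (IsWordSeries ℒ p q Ψm ∧ IsWordSeries ℒ p q Ψ0 ∧ IsWordSeries ℒ p q Ψp) ∧
      -- the terms of lowest order
      ∃ Pm P0 Pp : MvPowerSeries Var 𝔭,
        OnlyHigherMixedTerms Pm ∧ OnlyHigherMixedTerms P0 ∧ OnlyHigherMixedTerms Pp ∧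
        Ψm = gMinus q + orderTwo p q (Set.Iio 0) + Pm ∧
        Ψ0 = orderTwo p q {0} + P0 ∧
        Ψp = gPlus p + orderTwo p q (Set.Ioi 0) + Pp := by
  refine ⟨⟨(gPlus_eqMod p).toU_zero.expDefined, (gMinus_eqMod q).toU_zero.expDefined,
    fun Ψm Ψ0 Ψp h => ⟨h.eqMod.1.toU_zero.expDefined, h.eqMod.2.2.toU_zero.expDefined,
      h.eqMod.2.1.toU_zero.expDefined⟩⟩, ?_⟩
  obtain ⟨Ψ, hΨ0, hΨ, hiter⟩ := exists_fixedPoint_of_contraction (picard F p q ℒ)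
    (picard_eqMod_zero F p q ℒ) (picard_eqMod_succ F p q ℒ)
  have hword : IsWordSeries ℒ p q Ψ := by
    refine IsWordSeries.of_eqMod (fun k => ?_) hiter
    induction k with
    | zero => exact IsWordSeries.zero
    | succ k ih => rw [Function.iterate_succ_apply']; exact ih.picard
  have h3 := eqMod_three_of_picard_eq hp hq hΨ0 hΨ
  have h2 : EqMod 2 Ψ (gPlus p + gMinus q) := by
    have b := (EqMod.refl 2 (gPlus p + gMinus q)).add (lie_eqMod_two p q)
    rw [add_zero] at b
    exact (h3.mono (by omega)).trans b
  have hmix := hword.onlyMixedTerms hp hq h2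
  -- One estimate for Ψ serves all three remainders: they are its projections, and the projections
  -- of [g⁺, g⁻] are the prescribed second-order terms.
  have hhigh : OnlyHigherMixedTerms (Ψ - (gPlus p + gMinus q) - ⁅gPlus p, gMinus q⁆) := by
    intro d hd
    refine ⟨?_, ?_⟩
    · by_contra hc
      rw [orderA_add_orderB] at hc
      refine hd ?_
      rw [series_sub_apply, series_sub_apply, h3 d (by omega)]
      simp
    · by_cases hl : ⁅gPlus p, gMinus q⁆ d = 0
      · exact hmix d fun h => hd (by rw [series_sub_apply, h, hl, sub_zero])
      · have := orders_of_lie_ne_zero hl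
        omega
  have hfac := expU_mul_eq_of_picard_eq hp hΨ0 hΨ
  have hform : HasPrescribedForm ℒ p q (serProj ℒ (Set.Iio 0) Ψ) (serProj ℒ {0} Ψ)
      (serProj ℒ (Set.Ioi 0) Ψ) := by
    refine ⟨hasCoeffsIn_serProj ℒ _ _, hasCoeffsIn_serProj ℒ _ _, hasCoeffsIn_serProj ℒ _ _,
      _, _, _, ⟨hasCoeffsIn_serProj ℒ _ _, hmix.serProj _⟩,
      ⟨hasCoeffsIn_serProj ℒ _ _, hmix.serProj _⟩,
      ⟨hasCoeffsIn_serProj ℒ _ _, hmix.serProj _⟩, ?_, ?_, ?_⟩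
    · rw [serProj_sub, serProj_add, serProj_gPlus_of_disjoint hp disjoint_Iio_Ioi,
        serProj_gMinus_of_subset hq subset_rfl, zero_add, add_sub_cancel]
    · rw [serProj_sub, serProj_add, serProj_gPlus_of_disjoint hp disjoint_zero_Ioi,
        serProj_gMinus_of_disjoint hq disjoint_zero_Iio, zero_add, sub_zero]
    · rw [serProj_sub, serProj_add, serProj_gPlus_of_subset hp subset_rfl,
        serProj_gMinus_of_disjoint hq disjoint_Iio_Ioi.symm, add_zero, add_sub_cancel]
  refine ⟨_, _, _, ⟨hform, hfac⟩, ?_, ⟨hword.serProj_Iio, hword.serProj_zero, hword.serProj_Ioi⟩,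
    _, _, _, hhigh.serProj (ℒ := ℒ) (Set.Iio 0), hhigh.serProj (ℒ := ℒ) {0},
    hhigh.serProj (ℒ := ℒ) (Set.Ioi 0), ?_, ?_, ?_⟩
  · intro Φm Φ0 Φp hΦ h
    obtain ⟨a, b, c⟩ := hΦ.eqMod
    obtain ⟨a', b', c'⟩ := hform.eqMod
    exact eq_of_expU_mul_expU_mul_expU_eq a b c a' b' c' hΦ.1 hΦ.2.1 hΦ.2.2.1 hform.1 hform.2.1
      hform.2.2.1 (h.symm.trans hfac)
  · rw [serProj_sub, serProj_sub, serProj_add, serProj_gPlus_of_disjoint hp disjoint_Iio_Ioi,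
      serProj_gMinus_of_subset hq subset_rfl, serProj_lie_eq_orderTwo hp hq]
    abel
  · rw [serProj_sub, serProj_sub, serProj_add, serProj_gPlus_of_disjoint hp disjoint_zero_Ioi,
      serProj_gMinus_of_disjoint hq disjoint_zero_Iio, serProj_lie_eq_orderTwo hp hq]
    abel
  · rw [serProj_sub, serProj_sub, serProj_add, serProj_gPlus_of_subset hp subset_rfl,
      serProj_gMinus_of_disjoint hq disjoint_Iio_Ioi.symm, serProj_lie_eq_orderTwo hp hq]
    abel
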